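/- Let $\mathbb D$ be the open unit disc and $\mathbb T$ the unit circle. For Borel $A\subset\mathbb T$ let $|A|$ denote its arc length (so $|\mathbb T|=2\pi$). Let $0<\alpha\le 1$. The Dirichlet space $\mathcal D_\alpha$ consists of the analytic functions $f$ on $\mathbb D$ in the Hardy space $H^2$ whose boundary function $f^*(\zeta)=\lim_{r\to1^-}f(r\zeta)$ (which exists for almost every $\zeta\in\mathbb T$) satisfies $$\int_{\mathbb T}\int_{\mathbb T}\frac{|f^*(z)-f^*(w)|^2}{|z-w|^{1+\alpha}}\,\frac{|dz|}{2\pi}\frac{|dw|}{2\pi}<\infty .$$ A set $E\subset\mathbb T$ is a uniqueness set for $\mathcal D_\alpha$ if the only $f\in\mathcal D_\alpha$ such that $\lim_{r\to1^-}f(r\zeta)$ exists and equals $0$ for every $\zeta\in E$ is $f=0$. For $0\le s<1$ let $k_s(\zeta)=|1-\zeta|^{-s}$ if $s>0$ and $k_0(\zeta)=\big|\log|1-\zeta|\big|$, with $k_s(1)=+\infty$. For a Borel set $A\subset\mathbb T$ put $$C_s(A)=\Big(\inf_\mu\iint k_s(\zeta\bar\xi)\,d\mu(\xi)\,d\mu(\zeta)\Big)^{-1},$$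 where the infimum is over all Borel probability measures $\mu$ supported on a compact subset of $A$; $C_s(A)=0$ if there is no such $\mu$ of finite energy. **Theorem.** Let $0<\alpha\le1$ and let $E\subset\mathbb T$ be a Borel set of Lebesgue measure zero. Let $(I_n)_{n\ge0}$ be a sequence of pairwise disjoint nonempty open arcs of $\mathbb T$ with $E\subset\bigcup_n I_n$. Suppose that for some $\beta$ with $0<\beta\le\alpha$, $$\sum_{n}|I_n|\log\frac{|I_n|^{1+\alpha-\beta}}{C_{1-\beta}(E\cap I_n)}=-\infty ,$$ in the sense that the partial sums tend to $-\infty$, where a term with $C_{1-\beta}(E\cap I_n)=0$ is $+\infty$. Then $E$ is a uniqueness set for $\mathcal D_\alpha$. -/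

import Mathlib

open MeasureTheory Filter Topology
open scoped ENNReal

namespace DirichletUniqueness

noncomputable section

/-- The unit circle `𝕋`, as a subset of `ℂ`. -/
def unitCircle : Set ℂ := Metric.sphere 0 1

/-- Arc length `|dz|` on the unit circle (total mass `2π`), as a Borel measure on `ℂ`. -/
def arcLength : Measure ℂ :=
  (volume.restrict (Set.Ioc (-Real.pi) Real.pi)).map (circleMap 0 1)

/-- Normalized arc length `|dz| / 2π` on the unit circle (total mass `1`). -/
def normArcLength : Measure ℂ :=
  (ENNReal.ofReal (2 * Real.pi))⁻¹ • arcLength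

/-- Open arcs `{e^{it} : a < t < b}` of the unit circle, with `a < b ≤ a + 2π`. -/
def IsOpenArc (I : Set ℂ) : Prop :=
  ∃ a b : ℝ, a < b ∧ b ≤ a + 2 * Real.pi ∧ I = circleMap 0 1 '' Set.Ioo a b

/-- The kernel: `|1 - z|^{-s}` for `s ≠ 0` and `|log |1 - z||` for `s = 0`;
it takes the value `+∞` at `z = 1` (for `s ≥ 0`). -/
def kernel (s : ℝ) (z : ℂ) : ℝ≥0∞ :=
  if s = 0 then
    if z = 1 then ⊤ else ENNReal.ofReal |Real.log ‖1 - z‖|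
  else ‖1 - z‖ₑ ^ (-s)

/-- The `s`-energy `I_s(μ) = ∬ k_s(ζ ξ̄) dμ(ξ) dμ(ζ)`. -/
def energy (s : ℝ) (μ : Measure ℂ) : ℝ≥0∞ :=
  ∫⁻ ζ, ∫⁻ ξ, kernel s (ζ * (starRingEnd ℂ) ξ) ∂μ ∂μ

/-- The Borel probability measures supported on a compact subset of `E`. -/
def probMeasuresOn (E : Set ℂ) : Set (Measure ℂ) :=
  {μ | IsProbabilityMeasure μ ∧ ∃ K : Set ℂ, IsCompact K ∧ K ⊆ E ∧ μ Kᶜ = 0}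

/-- The capacity `C_s(E) = 1 / inf {I_s(μ) : μ ∈ P(E)}`; it is `0` if every `μ ∈ P(E)` has
infinite energy, in particular if `E` is empty. -/
def capacity (s : ℝ) (E : Set ℂ) : ℝ≥0∞ :=
  (⨅ μ ∈ probMeasuresOn E, energy s μ)⁻¹

/-- `f` has the radial limit `l` at `ζ`, that is `f(rζ) → l` as `r → 1-`. -/
def HasRadialLimit (f : ℂ → ℂ) (ζ l : ℂ) : Prop :=
  Tendsto (fun r : ℝ => f (r * ζ)) (𝓝[<] 1) (𝓝 l)

/-- The boundary function `f*(ζ) = lim_{r → 1-} f(rζ)`. It has an arbitrary value where the limit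
does not exist; for `f` in the Hardy space `H²` this happens on a null set only. -/
def boundaryValue (f : ℂ → ℂ) (ζ : ℂ) : ℂ :=
  limUnder (𝓝[<] (1 : ℝ)) (fun r : ℝ => f (r * ζ))

/-- The Hardy space `H²` of the unit disc. -/
def MemHardyTwo (f : ℂ → ℂ) : Prop :=
  DifferentiableOn ℂ f (Metric.ball 0 1) ∧
    ∃ M : ℝ≥0∞, M ≠ ⊤ ∧ ∀ r ∈ Set.Ico (0 : ℝ) 1,
      ∫⁻ ζ, ‖f (r * ζ)‖ₑ ^ 2 ∂normArcLength ≤ M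

/-- `𝒟_α(g) = ∬ |g(z) - g(w)|² / |z - w|^{1+α} |dz|/2π |dw|/2π` for a function `g` on the unit
circle (the diagonal is a null set; the integrand is `0` there). -/
def dirichletIntegral (α : ℝ) (g : ℂ → ℂ) : ℝ≥0∞ :=
  ∫⁻ z, ∫⁻ w, ‖g z - g w‖ₑ ^ 2 / ‖z - w‖ₑ ^ (1 + α) ∂normArcLength ∂normArcLength

/-- The Dirichlet space `𝒟_α`: functions in `H²` whose boundary function has a finite
Dirichlet integral. -/
def MemDirichlet (α : ℝ) (f : ℂ → ℂ) : Prop :=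
  MemHardyTwo f ∧ dirichletIntegral α (boundaryValue f) < ⊤

/-- `E` is a uniqueness set for `𝒟_α`: a function in `𝒟_α` with radial limit `0` at every point
of `E` vanishes on the unit disc. -/
def IsUniquenessSet (α : ℝ) (E : Set ℂ) : Prop :=
  ∀ f : ℂ → ℂ, MemDirichlet α f → (∀ ζ ∈ E, HasRadialLimit f ζ 0) →
    ∀ z ∈ Metric.ball (0 : ℂ) 1, f z = 0

/-- The term `|I| log (|I|^{1+α-β} / C_{1-β}(E ∩ I))`, an extended real number: it is `+∞` if
`C_{1-β}(E ∩ I) = 0`. -/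
def logTerm (α β : ℝ) (E I : Set ℂ) : EReal :=
  (arcLength I : EReal) *
    ENNReal.log (arcLength I ^ (1 + α - β) / capacity (1 - β) (E ∩ I))

end

end DirichletUniqueness

/-! Suppose a nonzero f in 𝒟_α has radial limit 0 on E, and let u be its boundary function. Since f
is a nonzero element of H², log⁻|u| is integrable (`MemHardyTwo.lintegral_negLog_lt_top`). The
contradiction comes from making u too small on the arcs I = I_n.

The main tool is a local Poincaré inequality (`exists_poincare_capacity`): (1/|I|) ∫_I |u|² ≤ C
|I|^{α-β} D_I / C_{1-β}(E ∩ I), where D_I is the Dirichlet integral of order α over I × I only.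
Jensen's inequality for the logarithm (`neg_two_mul_negLog_le`) and log t ≤ t then give -2 ∫_I
log⁻|u| ≤ |I| log(|I|^{1+α-β} / C_{1-β}(E ∩ I)) + C (D_I + |I|). The arcs are disjoint, so the
integrals of log⁻|u|, the D_I and the lengths all have finite sums. The partial sums of the
logarithmic terms are therefore bounded below, against the assumption.

For the Poincaré inequality, let μ be a probability measure of finite (1-β)-energy carried by E ∩ I,
and halve I repeatedly. The mean of u over I is joined to the Poisson integral f(r_N z), 1 - r_N
comparable to |I|/2^N, through the means over the dyadic subarcs containing z. Integrating in μ and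
applying Cauchy–Schwarz bounds the telescoping part by a discretized energy of μ times the local
Dirichlet integral (`sq_lintegral_dyadicMean_sub_le`). The last link, from dyadic mean to Poisson
integral, involves the whole circle but carries a factor tending to 0
(`sq_lintegral_poisson_sub_dyadicMean_le`). As f(r_N z) → 0 for μ-almost every z, the mean of u over
I is controlled (`sq_enorm_dyadicMean_le`). -/

namespace DirichletUniqueness

/-! ### Arc length and the angular coordinate. -/

/-- The determination of the argument of `z` in `[a, a + 2π)`. -/
noncomputable def angle (a : ℝ) (z : ℂ) : ℝ :=
  a + 2 * Real.pi * Int.fract ((Complex.arg z - a) / (2 * Real.pi))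

lemma measurable_angle (a : ℝ) : Measurable (angle a) := by
  unfold angle
  fun_prop

lemma angle_mem_Ico (a : ℝ) (z : ℂ) : angle a z ∈ Set.Ico a (a + 2 * Real.pi) := by
  have h0 := Int.fract_nonneg ((Complex.arg z - a) / (2 * Real.pi))
  have h1 := Int.fract_lt_one ((Complex.arg z - a) / (2 * Real.pi))
  have hp := Real.two_pi_pos
  constructor <;> unfold angle <;> nlinarith

lemma circleMap_angle (a : ℝ) {z : ℂ} (hz : ‖z‖ = 1) : circleMap 0 1 (angle a z) = z := by
  have hp := Real.two_pi_pos
  have h : angle a z = Complex.arg z -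
      (⌊(Complex.arg z - a) / (2 * Real.pi)⌋ : ℤ) * (2 * Real.pi) := by
    unfold angle Int.fract
    field_simp
    ring
  rw [h, (periodic_circleMap 0 1).sub_int_mul_eq, circleMap_zero]
  conv_rhs => rw [← Complex.norm_mul_exp_arg_mul_I z, hz]

lemma angle_circleMap {a t : ℝ} (ht : t ∈ Set.Ico a (a + 2 * Real.pi)) :
    angle a (circleMap 0 1 t) = t := by
  have h1 := angle_mem_Ico a (circleMap 0 1 t)
  refine eq_of_circleMap_eq (c := 0) one_ne_zero ?_ (circleMap_angle a (by simp))
  rw [abs_lt]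
  constructor <;> linarith [h1.1, h1.2, ht.1, ht.2]

/-- Every interval of length 2π gives the same measure, because each one is the pushforward of Haar
measure on ℝ/2πℤ. This lets the cut be placed at the end of any given arc. -/
lemma arcLength_eq_map (a : ℝ) :
    arcLength = (volume.restrict (Set.Ico a (a + 2 * Real.pi))).map (circleMap 0 1) := by
  have : Fact (0 < 2 * Real.pi) := ⟨Real.two_pi_pos⟩
  have h (c : ℝ) : (volume.restrict (Set.Ioc c (c + 2 * Real.pi))).map (circleMap 0 1) =
      (volume : Measure (AddCircle (2 * Real.pi))).map (periodic_circleMap 0 1).lift := by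
    have hm := AddCircle.measurePreserving_mk (2 * Real.pi) c
    rw [← hm.map_eq, Measure.map_map _ hm.measurable]
    · rfl
    · refine Continuous.measurable ?_
      exact continuous_coinduced_dom.2 (continuous_circleMap 0 1)
  rw [restrict_Ico_eq_restrict_Ioc, h a, arcLength]
  convert h (-Real.pi) using 4
  ring

lemma map_angle_arcLength (a : ℝ) :
    arcLength.map (angle a) = volume.restrict (Set.Ico a (a + 2 * Real.pi)) := by
  rw [arcLength_eq_map a, Measure.map_map (measurable_angle a) (measurable_circleMap 0 1)]
  conv_rhs => rw [← Measure.map_id (μ := volume.restrict (Set.Ico a (a + 2 * Real.pi)))]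
  refine Measure.map_congr ?_
  filter_upwards [ae_restrict_mem measurableSet_Ico] with t ht
  exact angle_circleMap ht

lemma arcLength_univ : arcLength Set.univ = ENNReal.ofReal (2 * Real.pi) := by
  rw [arcLength, Measure.map_apply (measurable_circleMap 0 1) MeasurableSet.univ]
  rw [Set.preimage_univ, Measure.restrict_apply_univ, Real.volume_Ioc]
  ring_nf

instance : IsFiniteMeasure arcLength := ⟨by rw [arcLength_univ]; exact ENNReal.ofReal_lt_top⟩

instance : IsProbabilityMeasure normArcLength := ⟨by
  rw [normArcLength, Measure.smul_apply, arcLength_univ, smul_eq_mul]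
  exact ENNReal.inv_mul_cancel (by simp [Real.pi_pos]) ENNReal.ofReal_ne_top⟩

lemma arcLength_eq_smul : arcLength = ENNReal.ofReal (2 * Real.pi) • normArcLength := by
  rw [normArcLength, smul_smul, ENNReal.mul_inv_cancel (by simp [Real.pi_pos])
    ENNReal.ofReal_ne_top, one_smul]

lemma normArcLength_absolutelyContinuous : normArcLength ≪ arcLength :=
  Measure.smul_absolutelyContinuous

lemma arcLength_absolutelyContinuous : arcLength ≪ normArcLength := by
  rw [arcLength_eq_smul]
  exact Measure.smul_absolutelyContinuous

lemma ae_arcLength_norm_eq_one : ∀ᵐ z ∂arcLength, ‖z‖ = 1 := by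
  rw [arcLength, ae_map_iff (measurable_circleMap 0 1).aemeasurable
    (measurableSet_eq_fun measurable_norm measurable_const)]
  simp

lemma ae_normArcLength_norm_eq_one : ∀ᵐ z ∂normArcLength, ‖z‖ = 1 :=
  normArcLength_absolutelyContinuous ae_arcLength_norm_eq_one

lemma norm_sub_le_abs_angle_sub (a : ℝ) {z w : ℂ} (hz : ‖z‖ = 1) (hw : ‖w‖ = 1) :
    ‖z - w‖ ≤ |angle a z - angle a w| := by
  have h := (lipschitzWith_circleMap 0 1).dist_le_mul (angle a z) (angle a w)
  rw [circleMap_angle a hz, circleMap_angle a hw] at h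
  simpa [dist_eq_norm] using h

/-- The chord is 2|sin((t - s)/2)|, and |sin x| ≥ (2/π)|x| for |x| ≤ π/2. -/
lemma abs_le_pi_mul_norm_circleMap_sub {t s : ℝ} (h : |t - s| ≤ Real.pi) :
    |t - s| ≤ Real.pi / 2 * ‖circleMap 0 1 t - circleMap 0 1 s‖ := by
  have h1 : circleMap 0 1 t - circleMap 0 1 s =
      circleMap 0 1 s * (Complex.exp (Complex.I * ((t - s : ℝ) : ℂ)) - 1) := by
    simp only [circleMap_zero]
    rw [mul_sub, mul_assoc, ← Complex.exp_add]
    push_cast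
    ring_nf
  rw [h1, norm_mul, Complex.norm_exp_I_mul_ofReal_sub_one]
  have h2 := Real.mul_abs_le_abs_sin (x := (t - s) / 2) (by rw [abs_div]; simpa using by linarith)
  have hp := Real.pi_pos
  simp only [norm_circleMap_zero, abs_one, one_mul, norm_mul, Real.norm_eq_abs, abs_two]
  rw [abs_div, abs_two] at h2
  field_simp at h2
  nlinarith

lemma arcLength_closedBall_le {z : ℂ} (hz : ‖z‖ = 1) (r : ℝ) :
    arcLength (Metric.closedBall z r) ≤ ENNReal.ofReal (Real.pi * r) := by
  have hp := Real.pi_pos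
  set s := Complex.arg z
  have hs : circleMap 0 1 s = z := by
    rw [circleMap_zero]
    conv_rhs => rw [← Complex.norm_mul_exp_arg_mul_I z, hz]
  rw [arcLength_eq_map (s - Real.pi), Measure.map_apply (measurable_circleMap 0 1)
    Metric.isClosed_closedBall.measurableSet, Measure.restrict_apply
    (measurable_circleMap 0 1 Metric.isClosed_closedBall.measurableSet)]
  calc _ ≤ volume (Set.Icc (s - Real.pi / 2 * r) (s + Real.pi / 2 * r)) := by
        refine measure_mono ?_
        rintro t ⟨ht, ht1, ht2⟩
        have h0 : |t - s| ≤ Real.pi := by rw [abs_le]; constructor <;> linarith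
        have h1 := abs_le_pi_mul_norm_circleMap_sub h0
        rw [Set.mem_preimage, Metric.mem_closedBall, dist_eq_norm] at ht
        rw [hs] at h1
        have h2 : |t - s| ≤ Real.pi / 2 * r := h1.trans (by gcongr)
        rw [abs_le] at h2
        constructor <;> linarith
    _ = _ := by rw [Real.volume_Icc]; congr 1; ring

lemma integral_normArcLength {E : Type*} [NormedAddCommGroup E] [NormedSpace ℝ E]
    {φ : ℂ → E} (hφ : AEStronglyMeasurable φ normArcLength) :
    ∫ z, φ z ∂normArcLength = Real.circleAverage φ 0 1 := by
  have h2 : AEStronglyMeasurable φ arcLength := hφ.mono_ac arcLength_absolutelyContinuous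
  have hp := Real.two_pi_pos
  rw [Real.circleAverage_def, normArcLength, integral_smul_measure, ENNReal.toReal_inv,
    ENNReal.toReal_ofReal hp.le]
  congr 1
  rw [arcLength_eq_map 0] at h2 ⊢
  rw [integral_map (measurable_circleMap 0 1).aemeasurable h2,
    restrict_Ico_eq_restrict_Ioc, zero_add, intervalIntegral.integral_of_le hp.le]

lemma IsOpenArc.exists_angle {I : Set ℂ} (hI : IsOpenArc I) : ∃ a l : ℝ, 0 < l ∧
    l ≤ 2 * Real.pi ∧ I = {z | ‖z‖ = 1 ∧ angle a z ∈ Set.Ioo a (a + l)} := by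
  obtain ⟨a, b, hab, hb, rfl⟩ := hI
  refine ⟨a, b - a, by linarith, by linarith, ?_⟩
  ext z
  simp only [Set.mem_image, Set.mem_ofPred_eq, add_sub_cancel]
  constructor
  · rintro ⟨t, ht, rfl⟩
    rw [angle_circleMap ⟨ht.1.le, by linarith [ht.2]⟩]
    exact ⟨by simp, ht⟩
  · rintro ⟨hz, ht⟩
    exact ⟨_, ht, circleMap_angle a hz⟩

lemma measurableSet_norm_eq_one : MeasurableSet {z : ℂ | ‖z‖ = 1} :=
  measurableSet_eq_fun measurable_norm measurable_const

lemma measurableSet_angle_preimage (a : ℝ) {s : Set ℝ} (hs : MeasurableSet s) :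
    MeasurableSet {z | ‖z‖ = 1 ∧ angle a z ∈ s} :=
  measurableSet_norm_eq_one.inter (measurable_angle a hs)

lemma arcLength_angle_preimage (a : ℝ) {s : Set ℝ} (hs : MeasurableSet s) :
    arcLength {z | ‖z‖ = 1 ∧ angle a z ∈ s} = volume (s ∩ Set.Ico a (a + 2 * Real.pi)) := by
  rw [← Measure.restrict_apply hs, ← map_angle_arcLength a,
    Measure.map_apply (measurable_angle a) hs]
  refine measure_congr ?_
  filter_upwards [ae_arcLength_norm_eq_one] with z hz
  apply propext
  exact ⟨fun h => h.2, fun h => ⟨hz, h⟩⟩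

lemma IsOpenArc.measurableSet {I : Set ℂ} (hI : IsOpenArc I) : MeasurableSet I := by
  obtain ⟨a, l, -, -, rfl⟩ := hI.exists_angle
  exact measurableSet_angle_preimage a measurableSet_Ioo

lemma aestronglyMeasurable_of_continuousOn {E : Type*} [NormedAddCommGroup E] {φ : ℂ → E}
    (hφ : ContinuousOn φ (Metric.sphere 0 1)) : AEStronglyMeasurable φ normArcLength := by
  have h : normArcLength.restrict (Metric.sphere 0 1) = normArcLength :=
    Measure.restrict_eq_self_of_ae_mem (by simpa using ae_normArcLength_norm_eq_one)
  rw [← h]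
  exact hφ.aestronglyMeasurable_of_isCompact (isCompact_sphere 0 1)
    Metric.isClosed_sphere.measurableSet

/-! ### The Poisson kernel. -/

lemma poissonKernel_zero_apply {z w : ℂ} (hw : ‖w‖ = 1) :
    poissonKernel 0 z w = (1 - ‖z‖ ^ 2) / ‖w - z‖ ^ 2 := by
  simp [poissonKernel, hw]

lemma poissonKernel_zero_nonneg {z w : ℂ} (hz : ‖z‖ < 1) (hw : ‖w‖ = 1) :
    0 ≤ poissonKernel 0 z w := by
  rw [poissonKernel_zero_apply hw]
  have := norm_nonneg z
  exact div_nonneg (by nlinarith) (by positivity)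

lemma poissonKernel_zero_le {z w : ℂ} (hz : ‖z‖ < 1) (hw : ‖w‖ = 1) :
    poissonKernel 0 z w ≤ 1 / (1 - ‖z‖) ^ 2 := by
  rw [poissonKernel_zero_apply hw]
  have h : 1 - ‖z‖ ≤ ‖w - z‖ := hw ▸ norm_sub_norm_le w z
  have h1 : 0 < 1 - ‖z‖ := by linarith
  gcongr
  nlinarith [norm_nonneg z]

lemma measurable_poissonKernel (z : ℂ) : Measurable (poissonKernel 0 z) := by
  unfold poissonKernel
  fun_prop

lemma integral_poissonKernel_mul {f : ℂ → ℂ} (hf : DiffContOnCl ℂ f (Metric.ball 0 1))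
    {z : ℂ} (hz : ‖z‖ < 1) :
    ∫ w, (poissonKernel 0 z w : ℂ) * f w ∂normArcLength = f z := by
  rw [integral_normArcLength]
  · exact hf.circleAverage_poissonKernel_smul (w := z) (by simpa using hz)
  · refine AEStronglyMeasurable.mul ?_ ?_
    · exact (Complex.measurable_ofReal.comp (measurable_poissonKernel z)).aestronglyMeasurable
    · refine aestronglyMeasurable_of_continuousOn (hf.continuousOn.mono ?_)
      rw [closure_ball _ one_ne_zero]
      exact Metric.sphere_subset_closedBall

lemma integral_poissonKernel {z : ℂ} (hz : ‖z‖ < 1) :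
    ∫ w, poissonKernel 0 z w ∂normArcLength = 1 := by
  have h := integral_poissonKernel_mul (f := fun _ => 1) diffContOnCl_const hz
  simp only [mul_one] at h
  rw [integral_complex_ofReal] at h
  exact_mod_cast h

lemma memLp_poissonKernel {z : ℂ} (hz : ‖z‖ < 1) (p : ℝ≥0∞) :
    MemLp (fun w => (poissonKernel 0 z w : ℂ)) p normArcLength := by
  refine MemLp.of_bound
    (Complex.measurable_ofReal.comp (measurable_poissonKernel z)).aestronglyMeasurable
    (1 / (1 - ‖z‖) ^ 2) ?_
  filter_upwards [ae_normArcLength_norm_eq_one] with w hw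
  rw [Complex.norm_real, Real.norm_of_nonneg (poissonKernel_zero_nonneg hz hw)]
  exact poissonKernel_zero_le hz hw

lemma diffContOnCl_comp_mul {f : ℂ → ℂ} (hf : DifferentiableOn ℂ f (Metric.ball 0 1)) {r : ℝ}
    (hr : r ∈ Set.Ico (0 : ℝ) 1) : DiffContOnCl ℂ (fun w => f (r * w)) (Metric.ball 0 1) := by
  refine DifferentiableOn.diffContOnCl ?_
  rw [closure_ball _ one_ne_zero]
  refine hf.comp (by fun_prop) ?_
  intro w hw
  simp only [Metric.mem_closedBall, dist_zero_right, Metric.mem_ball, norm_mul,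
    Complex.norm_real, Real.norm_of_nonneg hr.1] at hw ⊢
  nlinarith [hr.1, hr.2, norm_nonneg w]

lemma continuousOn_comp_mul {f : ℂ → ℂ} (hf : DifferentiableOn ℂ f (Metric.ball 0 1)) {r : ℝ}
    (hr : r ∈ Set.Ico (0 : ℝ) 1) :
    ContinuousOn (fun w => f (r * w)) (Metric.closedBall 0 1) := by
  have := (diffContOnCl_comp_mul hf hr).continuousOn
  rwa [closure_ball _ one_ne_zero] at this

/-! ### Boundary functions in H². -/

lemma eLpNorm_two_le_of_lintegral_sq_le {μ : Measure ℂ} {g : ℂ → ℂ} {M : ℝ≥0∞}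
    (h : ∫⁻ w, ‖g w‖ₑ ^ 2 ∂μ ≤ M) : eLpNorm g 2 μ ≤ M ^ (1 / 2 : ℝ) := by
  rw [eLpNorm_eq_lintegral_rpow_enorm_toReal (by norm_num) (by norm_num)]
  simp only [ENNReal.toReal_ofNat, ENNReal.rpow_ofNat]
  gcongr

/-- The dilates f(r·) are bounded in L², so by Banach–Alaoglu they have a weak cluster point g as r
→ 1. Pairing with a fixed Poisson kernel gives f(rz), which converges to f(z); hence a cluster point
suffices and no subsequence is needed. -/
lemma MemHardyTwo.exists_poisson_representation {f : ℂ → ℂ} (hf : MemHardyTwo f) :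
    ∃ g : ℂ → ℂ, MemLp g 2 normArcLength ∧ ∀ z : ℂ, ‖z‖ < 1 →
      f z = ∫ w, (poissonKernel 0 z w : ℂ) * g w ∂normArcLength := by
  obtain ⟨hd, M, hM, hb⟩ := hf
  set σ := normArcLength
  have hmem : ∀ r ∈ Set.Ico (0 : ℝ) 1, MemLp (fun w => f (r * w)) 2 σ := fun r hr =>
    ⟨aestronglyMeasurable_of_continuousOn ((continuousOn_comp_mul hd hr).mono
      Metric.sphere_subset_closedBall), (eLpNorm_two_le_of_lintegral_sq_le (hb r hr)).trans_lt
        (ENNReal.rpow_lt_top_of_nonneg (by norm_num) hM)⟩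
  let F : ℝ → Lp ℂ 2 σ := fun r =>
    if hr : r ∈ Set.Ico (0 : ℝ) 1 then (hmem r hr).toLp else 0
  have hF : ∀ r (hr : r ∈ Set.Ico (0 : ℝ) 1), F r = (hmem r hr).toLp := fun r hr => dif_pos hr
  have hFn : ∀ r, ‖F r‖ ≤ (M ^ (1 / 2 : ℝ)).toReal := by
    intro r
    by_cases hr : r ∈ Set.Ico (0 : ℝ) 1
    · rw [hF r hr, Lp.norm_toLp]
      exact ENNReal.toReal_mono (ENNReal.rpow_lt_top_of_nonneg (by norm_num) hM).ne
        (eLpNorm_two_le_of_lintegral_sq_le (hb r hr))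
    · rw [show F r = 0 from dif_neg hr, norm_zero]
      positivity
  let Φ : ℝ → WeakDual ℂ (Lp ℂ 2 σ) := fun r =>
    StrongDual.toWeakDual (InnerProductSpace.toDual ℂ (Lp ℂ 2 σ) (F r))
  obtain ⟨φ, -, hφ⟩ := (WeakDual.isCompact_closedBall (𝕜 := ℂ) (0 : StrongDual ℂ (Lp ℂ 2 σ))
    (M ^ (1 / 2 : ℝ)).toReal).exists_mapClusterPt (f := 𝓝[<] (1 : ℝ)) (u := Φ) (by
      rw [le_principal_iff, mem_map]
      refine univ_mem' fun r => ?_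
      simpa [Φ] using hFn r)
  refine ⟨(InnerProductSpace.toDual ℂ (Lp ℂ 2 σ)).symm (WeakDual.toStrongDual φ), Lp.memLp _, ?_⟩
  intro z hz
  set G := (InnerProductSpace.toDual ℂ (Lp ℂ 2 σ)).symm (WeakDual.toStrongDual φ)
  set P : Lp ℂ 2 σ := (memLp_poissonKernel hz 2).toLp
  -- The inner product is conjugate linear in its first slot and the Poisson kernel is real, so the
  -- pairing yields the conjugate of the Poisson integral.
  have hinner : ∀ H : Lp ℂ 2 σ, inner ℂ H P =
      (starRingEnd ℂ) (∫ w, (poissonKernel 0 z w : ℂ) * H w ∂σ) := by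
    intro H
    rw [L2.inner_def, ← integral_conj]
    refine integral_congr_ae ?_
    filter_upwards [(memLp_poissonKernel hz 2).coeFn_toLp] with w hw
    simp only [P]
    rw [hw]
    simp
  have h1 : MapClusterPt (φ P) (𝓝[<] (1 : ℝ)) (fun r => Φ r P) :=
    hφ.continuousAt_comp (WeakDual.eval_continuous P).continuousAt
  have h2 : Tendsto (fun r => Φ r P) (𝓝[<] (1 : ℝ)) (𝓝 ((starRingEnd ℂ) (f z))) := by
    have h3 : Tendsto (fun r : ℝ => (starRingEnd ℂ) (f (r * z))) (𝓝[<] (1 : ℝ))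
        (𝓝 ((starRingEnd ℂ) (f z))) := by
      refine (Complex.continuous_conj.tendsto _).comp ?_
      have hc : ContinuousAt f z :=
        (hd.differentiableAt (Metric.isOpen_ball.mem_nhds (by simpa using hz))).continuousAt
      have : Tendsto (fun r : ℝ => (r : ℂ) * z) (𝓝[<] 1) (𝓝 z) := by
        have : Continuous fun r : ℝ => (r : ℂ) * z := by fun_prop
        simpa using this.continuousWithinAt (s := Set.Iio 1) (x := 1) |>.tendsto
      exact hc.tendsto.comp this
    refine h3.congr' ?_
    filter_upwards [Ioo_mem_nhdsLT (show (0 : ℝ) < 1 by norm_num)] with r hr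
    have hr' : r ∈ Set.Ico (0 : ℝ) 1 := ⟨hr.1.le, hr.2⟩
    change _ = inner ℂ (F r) P
    rw [hinner, hF r hr', ← integral_poissonKernel_mul (diffContOnCl_comp_mul hd hr') hz]
    congr 1
    refine integral_congr_ae ?_
    filter_upwards [(hmem r hr').coeFn_toLp] with w hw
    rw [hw]
  have h4 : φ P = (starRingEnd ℂ) (f z) := by
    exact eq_of_nhds_neBot (NeBot.mono h1 (inf_le_inf_left _ h2))
  have h5 : φ P = inner ℂ G P := by
    simp [G, InnerProductSpace.toDual_symm_apply]
  rw [h5, hinner] at h4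
  exact ((starRingEnd ℂ).injective h4).symm

lemma norm_ofReal_mul_lt_one {z : ℂ} (hz : ‖z‖ = 1) {r : ℝ} (hr : r ∈ Set.Ico (0 : ℝ) 1) :
    ‖(r : ℂ) * z‖ < 1 := by
  rw [norm_mul, hz, Complex.norm_real, Real.norm_of_nonneg hr.1, mul_one]
  exact hr.2

/-- Both 1 - r and |w - z| are at most 2|w - rz|, which costs a factor 4; the remaining 2 is from 1
- r² ≤ 2(1 - r). -/
lemma poissonKernel_le_of_norm_eq_one {z w : ℂ} (hz : ‖z‖ = 1) (hw : ‖w‖ = 1) {r : ℝ}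
    (hr : r ∈ Set.Ico (0 : ℝ) 1) :
    poissonKernel 0 (r * z) w ≤ 8 * (1 - r) / max (1 - r) ‖w - z‖ ^ 2 := by
  have hn : ‖(r : ℂ) * z‖ = r := by
    rw [norm_mul, hz, Complex.norm_real, Real.norm_of_nonneg hr.1, mul_one]
  have h0 : 0 < 1 - r := by linarith [hr.2]
  rw [poissonKernel_zero_apply hw, hn]
  have h1 : 1 - r ≤ ‖w - r * z‖ := by
    have := norm_sub_norm_le w (r * z)
    rwa [hw, hn] at this
  have h2 : ‖w - z‖ ≤ 2 * ‖w - r * z‖ := by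
    have h3 : ‖(r : ℂ) * z - z‖ = 1 - r := by
      rw [show (r : ℂ) * z - z = ((r - 1 : ℝ) : ℂ) * z by push_cast; ring, norm_mul, hz,
        Complex.norm_real, Real.norm_eq_abs, abs_of_neg (by linarith)]
      ring
    have := norm_sub_le_norm_sub_add_norm_sub w (r * z) z
    linarith
  have h3 : max (1 - r) ‖w - z‖ ≤ 2 * ‖w - r * z‖ := max_le (by linarith) h2
  have h4 : 0 < max (1 - r) ‖w - z‖ := lt_max_of_lt_left h0
  have h5 : 0 < ‖w - r * z‖ := by linarith
  rw [div_le_div_iff₀ (by positivity) (by positivity)]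
  calc (1 - r ^ 2) * max (1 - r) ‖w - z‖ ^ 2 ≤ (2 * (1 - r)) * (2 * ‖w - r * z‖) ^ 2 := by
        gcongr
        nlinarith [hr.1, hr.2]
    _ = _ := by ring

lemma lintegral_poissonKernel {z : ℂ} (hz : ‖z‖ < 1) :
    ∫⁻ w, ENNReal.ofReal (poissonKernel 0 z w) ∂normArcLength = 1 := by
  rw [← ofReal_integral_eq_lintegral_ofReal, integral_poissonKernel hz, ENNReal.ofReal_one]
  · have := (memLp_poissonKernel hz 1).re
    rw [memLp_one_iff_integrable] at this
    simpa using this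
  · filter_upwards [ae_normArcLength_norm_eq_one] with w hw
    exact poissonKernel_zero_nonneg hz hw

/-- The index j is the least one with d ≤ 2^j δ; minimality gives d > 2^(j-1) δ when j > 0. This is
the majorization of the Poisson kernel by indicators of dyadic balls. -/
lemma exists_two_pow_mul_bound {δ d : ℝ} (hδ : 0 < δ) :
    ∃ j : ℕ, d ≤ 2 ^ j * δ ∧ 8 * δ / max δ d ^ 2 ≤ 32 / δ * (1 / 4) ^ j := by
  have hex : ∃ j : ℕ, d ≤ 2 ^ j * δ := by
    obtain ⟨j, hj⟩ := pow_unbounded_of_one_lt (d / δ) (one_lt_two (α := ℝ))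
    exact ⟨j, by rw [div_lt_iff₀ hδ] at hj; exact hj.le⟩
  classical
  refine ⟨Nat.find hex, Nat.find_spec hex, ?_⟩
  rcases Nat.eq_zero_or_pos (Nat.find hex) with h0 | h0
  · rw [h0, pow_zero, mul_one]
    calc 8 * δ / max δ d ^ 2 ≤ 8 * δ / δ ^ 2 := by gcongr; exact le_max_left _ _
      _ = 8 / δ := by field_simp
      _ ≤ _ := by gcongr; norm_num
  · have h1 := Nat.find_min hex (Nat.sub_lt h0 one_pos)
    obtain ⟨m, hm⟩ : ∃ m, Nat.find hex = m + 1 := ⟨_, (Nat.succ_pred_eq_of_pos h0).symm⟩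
    rw [hm] at h1 ⊢
    simp only [Nat.add_sub_cancel, not_le] at h1
    calc 8 * δ / max δ d ^ 2 ≤ 8 * δ / (2 ^ m * δ) ^ 2 := by
          gcongr; exact h1.le.trans (le_max_right _ _)
      _ = 32 / δ * (1 / 4) ^ (m + 1) := by
          have h2 : (4 : ℝ) ^ m = (2 ^ m) ^ 2 := by rw [← pow_mul, mul_comm, pow_mul]; norm_num
          rw [one_div, inv_pow, pow_succ 4, h2]
          field_simp
          norm_num

/-- The kernel is dominated by a sum of indicators of the balls of radius 2^j (1 - r), with weights
32 · 4^{-j}/(1 - r). A ball of that radius carries at most ε 2^j (1 - r), so the total is Σ 32 ε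
2^{-j} = 64 ε. -/
lemma lintegral_poissonKernel_mul_le {z : ℂ} (hz : ‖z‖ = 1) {r : ℝ}
    (hr : r ∈ Set.Ico (0 : ℝ) 1) {h : ℂ → ℝ≥0∞} (hh : AEMeasurable h normArcLength) {ε : ℝ}
    (hε : 0 ≤ ε) (hb : ∀ t : ℝ, 0 < t →
      ∫⁻ w in Metric.closedBall z t, h w ∂normArcLength ≤ ENNReal.ofReal (ε * t)) :
    ∫⁻ w, ENNReal.ofReal (poissonKernel 0 (r * z) w) * h w ∂normArcLength ≤
      ENNReal.ofReal (64 * ε) := by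
  have h0 : 0 < 1 - r := by linarith [hr.2]
  set δ := 1 - r
  calc ∫⁻ w, ENNReal.ofReal (poissonKernel 0 (r * z) w) * h w ∂normArcLength
      ≤ ∫⁻ w, ∑' j : ℕ, ENNReal.ofReal (32 / δ * (1 / 4) ^ j) *
          (Metric.closedBall z (2 ^ j * δ)).indicator h w ∂normArcLength := by
        refine lintegral_mono_ae ?_
        filter_upwards [ae_normArcLength_norm_eq_one] with w hw
        obtain ⟨j, hj1, hj2⟩ := exists_two_pow_mul_bound (d := ‖w - z‖) h0
        refine le_trans ?_ (ENNReal.le_tsum j)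
        rw [Set.indicator_of_mem (by simpa [dist_eq_norm] using hj1)]
        gcongr
        exact (poissonKernel_le_of_norm_eq_one hz hw hr).trans hj2
    _ = ∑' j : ℕ, ENNReal.ofReal (32 / δ * (1 / 4) ^ j) *
          ∫⁻ w in Metric.closedBall z (2 ^ j * δ), h w ∂normArcLength := by
        rw [lintegral_tsum]
        · congr 1
          ext j
          rw [lintegral_const_mul'' _ (hh.indicator Metric.isClosed_closedBall.measurableSet),
            lintegral_indicator Metric.isClosed_closedBall.measurableSet]
        · intro j
          exact (hh.indicator Metric.isClosed_closedBall.measurableSet).const_mul _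
    _ ≤ ∑' j : ℕ, ENNReal.ofReal (32 * ε * (1 / 2) ^ j) := by
        refine ENNReal.tsum_le_tsum fun j => ?_
        grw [hb _ (by positivity), ← ENNReal.ofReal_mul (by positivity)]
        refine le_of_eq (congrArg _ ?_)
        have : (1 / 4 : ℝ) ^ j = (1 / 2) ^ j * (1 / 2) ^ j := by rw [← mul_pow]; norm_num
        have h2 : (1 / 2 : ℝ) ^ j * 2 ^ j = 1 := by rw [← mul_pow]; norm_num
        rw [this]
        field_simp
        linear_combination ε * h2
    _ = ENNReal.ofReal (64 * ε) := by
        rw [← ENNReal.ofReal_tsum_of_nonneg (fun j => by positivity)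
          (summable_geometric_two.mul_left _), tsum_mul_left, tsum_geometric_two]
        ring_nf

lemma normArcLength_closedBall_le {z : ℂ} (hz : ‖z‖ = 1) (r : ℝ) :
    normArcLength (Metric.closedBall z r) ≤ ENNReal.ofReal r := by
  have hp := Real.pi_pos
  rw [normArcLength, Measure.smul_apply, smul_eq_mul]
  grw [arcLength_closedBall_le hz r]
  rw [← ENNReal.ofReal_inv_of_pos (by positivity), ← ENNReal.ofReal_mul (by positivity)]
  rcases le_or_gt r 0 with h | h
  · rw [ENNReal.ofReal_of_nonpos]
    · exact zero_le
    · exact mul_nonpos_of_nonneg_of_nonpos (by positivity)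
        (mul_nonpos_of_nonneg_of_nonpos hp.le h)
  · refine ENNReal.ofReal_le_ofReal ?_
    field_simp
    norm_num

lemma enorm_integral_poissonKernel_sub_le {g : ℂ → ℂ} {z : ℂ} (hz : ‖z‖ < 1)
    (hg : Integrable (fun w => (poissonKernel 0 z w : ℂ) * g w) normArcLength) (c : ℂ) :
    ‖(∫ w, (poissonKernel 0 z w : ℂ) * g w ∂normArcLength) - c‖ₑ ≤
      ∫⁻ w, ENNReal.ofReal (poissonKernel 0 z w) * ‖g w - c‖ₑ ∂normArcLength := by
  have hP : Integrable (fun w => (poissonKernel 0 z w : ℂ)) normArcLength :=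
    memLp_one_iff_integrable.1 (memLp_poissonKernel hz 1)
  have h1 : c = ∫ w, (poissonKernel 0 z w : ℂ) * c ∂normArcLength := by
    rw [integral_mul_const, integral_complex_ofReal, integral_poissonKernel hz]
    simp
  conv_lhs => rw [h1]
  rw [← integral_sub hg (hP.mul_const c)]
  refine (enorm_integral_le_lintegral_enorm _).trans (lintegral_mono_ae ?_)
  filter_upwards [ae_normArcLength_norm_eq_one] with w hw
  rw [← mul_sub, enorm_mul]
  gcongr
  rw [← ofReal_norm, Complex.norm_real,
    Real.norm_of_nonneg (poissonKernel_zero_nonneg hz hw)]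

lemma integrable_poissonKernel_mul {g : ℂ → ℂ} {z : ℂ} (hz : ‖z‖ < 1)
    (hg : MemLp g 2 normArcLength) :
    Integrable (fun w => (poissonKernel 0 z w : ℂ) * g w) normArcLength :=
  (memLp_poissonKernel hz 2).integrable_mul hg

/-- **Fatou's theorem** for Poisson integrals of square integrable functions. -/
lemma ae_tendsto_integral_poissonKernel {g : ℂ → ℂ} (hg : MemLp g 2 normArcLength) :
    ∀ᵐ z ∂normArcLength, Tendsto
      (fun r : ℝ => ∫ w, (poissonKernel 0 (r * z) w : ℂ) * g w ∂normArcLength)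
      (𝓝[<] 1) (𝓝 (g z)) := by
  have hgi : Integrable g normArcLength := hg.integrable (by norm_num)
  filter_upwards [ae_normArcLength_norm_eq_one,
    (Besicovitch.vitaliFamily normArcLength).ae_tendsto_lintegral_enorm_sub_div
      hgi.locallyIntegrable] with z hz hL
  replace hL := hL.comp (Besicovitch.tendsto_filterAt normArcLength z)
  have hHfin : ∫⁻ w, ‖g w - g z‖ₑ ∂normArcLength ≠ ⊤ :=
    ((hgi.sub (integrable_const (g z))).2).ne
  set K := ∫⁻ w, ‖g w - g z‖ₑ ∂normArcLength
  have hm : AEMeasurable (fun w => ‖g w - g z‖ₑ) normArcLength :=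
    (hgi.1.sub aestronglyMeasurable_const).enorm
  rw [tendsto_iff_edist_tendsto_0, ENNReal.tendsto_nhds_zero]
  intro η hη
  -- The part near the Lebesgue point z contributes 64 ε, the part away from it ε.
  obtain ⟨ε, hε, hεη⟩ : ∃ ε : ℝ, 0 < ε ∧ ENNReal.ofReal (65 * ε) ≤ η := by
    rcases eq_or_ne η ⊤ with rfl | hη'
    · exact ⟨1, one_pos, le_top⟩
    · refine ⟨η.toReal / 65, div_pos (ENNReal.toReal_pos hη.ne' hη') (by norm_num), ?_⟩
      rw [mul_div_cancel₀ _ (by norm_num), ENNReal.ofReal_toReal hη']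
  have hev := (ENNReal.tendsto_nhds_zero.1 hL) (ENNReal.ofReal ε) (by simpa using hε)
  obtain ⟨t₁, ht₁, hsub⟩ := mem_nhdsGT_iff_exists_Ioc_subset.1 hev
  have ht₁ : 0 < t₁ := ht₁
  have hball : ∀ t : ℝ, 0 < t → ∫⁻ w in Metric.closedBall z t,
      (Metric.closedBall z t₁).indicator (fun w => ‖g w - g z‖ₑ) w ∂normArcLength ≤
        ENNReal.ofReal (ε * t) := by
    intro t ht
    rw [lintegral_indicator Metric.isClosed_closedBall.measurableSet,
      Measure.restrict_restrict Metric.isClosed_closedBall.measurableSet]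
    -- After the cut-off at radius t₁, only the ball of radius min t t₁ matters, where the Lebesgue
    -- point estimate applies; so the bound holds at every t.
    have hs : min t t₁ ∈ Set.Ioc 0 t₁ := ⟨lt_min ht ht₁, min_le_right _ _⟩
    have h1 : (∫⁻ w in Metric.closedBall z (min t t₁), ‖g w - g z‖ₑ ∂normArcLength) /
        normArcLength (Metric.closedBall z (min t t₁)) ≤ ENNReal.ofReal ε := hsub hs
    calc _ ≤ ∫⁻ w in Metric.closedBall z (min t t₁), ‖g w - g z‖ₑ ∂normArcLength := by
          refine lintegral_mono_set fun w hw => ?_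
          simpa [and_comm] using hw
      _ ≤ ENNReal.ofReal ε * normArcLength (Metric.closedBall z (min t t₁)) := by
          exact (ENNReal.div_le_iff_le_mul (Or.inr ENNReal.ofReal_ne_top)
            (Or.inl (measure_ne_top _ _))).1 h1
      _ ≤ ENNReal.ofReal ε * ENNReal.ofReal t := by
          gcongr
          exact (normArcLength_closedBall_le hz _).trans
            (ENNReal.ofReal_le_ofReal (min_le_left _ _))
      _ = _ := (ENNReal.ofReal_mul hε.le).symm
  have htail : Tendsto (fun r : ℝ => ENNReal.ofReal (8 * (1 - r) / t₁ ^ 2) * K)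
      (𝓝[<] 1) (𝓝 0) := by
    have h1 : Tendsto (fun r : ℝ => 8 * (1 - r) / t₁ ^ 2) (𝓝[<] 1) (𝓝 0) := by
      have : Continuous fun r : ℝ => 8 * (1 - r) / t₁ ^ 2 := by fun_prop
      simpa using this.continuousWithinAt (s := Set.Iio 1) (x := 1) |>.tendsto
    have h2 := ENNReal.Tendsto.mul_const (b := K) (ENNReal.tendsto_ofReal h1) (Or.inr hHfin)
    simpa using h2
  filter_upwards [Ico_mem_nhdsLT (show (0 : ℝ) < 1 by norm_num),
    (ENNReal.tendsto_nhds_zero.1 htail) (ENNReal.ofReal ε) (by simpa using hε)] with r hr hrt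
  have hrz := norm_ofReal_mul_lt_one hz hr
  rw [edist_eq_enorm_sub]
  refine (enorm_integral_poissonKernel_sub_le hrz (integrable_poissonKernel_mul hrz hg) _).trans ?_
  refine le_trans ?_ hεη
  calc ∫⁻ w, ENNReal.ofReal (poissonKernel 0 (r * z) w) * ‖g w - g z‖ₑ ∂normArcLength
      ≤ ∫⁻ w, (ENNReal.ofReal (poissonKernel 0 (r * z) w) *
          (Metric.closedBall z t₁).indicator (fun w => ‖g w - g z‖ₑ) w +
          ENNReal.ofReal (8 * (1 - r) / t₁ ^ 2) * ‖g w - g z‖ₑ) ∂normArcLength := by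
        refine lintegral_mono_ae ?_
        filter_upwards [ae_normArcLength_norm_eq_one] with w hw
        by_cases hwt : w ∈ Metric.closedBall z t₁
        · rw [Set.indicator_of_mem hwt]
          exact le_self_add
        · refine le_trans ?_ le_add_self
          gcongr
          refine (poissonKernel_le_of_norm_eq_one hz hw hr).trans ?_
          have : t₁ ≤ ‖w - z‖ := by
            rw [Metric.mem_closedBall, dist_eq_norm, not_le] at hwt
            exact hwt.le
          have hr2 := hr.2
          have h3 : t₁ ≤ max (1 - r) ‖w - z‖ := this.trans (le_max_right _ _)
          gcongr
    _ ≤ ENNReal.ofReal (64 * ε) + ENNReal.ofReal (8 * (1 - r) / t₁ ^ 2) * K := by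
        rw [lintegral_add_right' _ (hm.const_mul _), lintegral_const_mul'' _ hm]
        gcongr
        exact lintegral_poissonKernel_mul_le hz hr
          (hm.indicator Metric.isClosed_closedBall.measurableSet) hε.le hball
    _ ≤ ENNReal.ofReal (64 * ε) + ENNReal.ofReal ε := by gcongr
    _ = ENNReal.ofReal (65 * ε) := by
        rw [← ENNReal.ofReal_add (by positivity) hε.le]
        ring_nf

/-- A function in `H²` has radial limits almost everywhere, its boundary function is square
integrable, and it is the Poisson integral of its boundary function. -/
lemma MemHardyTwo.boundaryValue_spec {f : ℂ → ℂ} (hf : MemHardyTwo f) :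
    (∀ᵐ z ∂normArcLength, HasRadialLimit f z (boundaryValue f z)) ∧
    MemLp (boundaryValue f) 2 normArcLength ∧ ∀ z : ℂ, ‖z‖ < 1 →
      f z = ∫ w, (poissonKernel 0 z w : ℂ) * boundaryValue f w ∂normArcLength := by
  obtain ⟨g, hg, hfg⟩ := hf.exists_poisson_representation
  have hlim : ∀ᵐ z ∂normArcLength, HasRadialLimit f z (g z) := by
    filter_upwards [ae_normArcLength_norm_eq_one, ae_tendsto_integral_poissonKernel hg]
      with z hz ht
    refine ht.congr' ?_
    filter_upwards [Ico_mem_nhdsLT (show (0 : ℝ) < 1 by norm_num)] with r hr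
    exact (hfg _ (norm_ofReal_mul_lt_one hz hr)).symm
  have hae : g =ᵐ[normArcLength] boundaryValue f := by
    filter_upwards [hlim] with z hz
    rw [boundaryValue, Tendsto.limUnder_eq hz]
  refine ⟨?_, hg.ae_eq hae, fun z hz => ?_⟩
  · filter_upwards [hlim, hae] with z hz hz'
    rwa [← hz']
  · rw [hfg z hz]
    refine integral_congr_ae ?_
    filter_upwards [hae] with w hw
    rw [hw]

/-! ### Integrability of log⁻ of the boundary function. -/

/-- The negative part `log⁻ ‖x‖`, with the value `∞` at `x = 0`. -/
noncomputable def negLog (x : ℂ) : ℝ≥0∞ := (-ENNReal.log ‖x‖ₑ).toENNReal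

/-- The value ∞ at the origin is what gives continuity there, so Fatou's lemma applies without first
knowing that the boundary function is almost everywhere nonzero. -/
lemma continuous_negLog : Continuous negLog := by
  unfold negLog
  exact (continuous_neg.comp (ENNReal.continuous_log.comp continuous_enorm)).ereal_toENNReal

lemma negLog_zero : negLog 0 = ⊤ := by simp [negLog]

lemma negLog_of_ne_zero {x : ℂ} (hx : x ≠ 0) : negLog x = ENNReal.ofReal (-Real.log ‖x‖) := by
  rw [negLog, ← ofReal_norm, ENNReal.log_ofReal_of_pos (norm_pos_iff.2 hx), ← EReal.coe_neg,
    EReal.real_coe_toENNReal]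

lemma integrable_normArcLength_of_circleIntegrable {φ : ℂ → ℝ}
    (hm : AEStronglyMeasurable φ normArcLength) (hφ : CircleIntegrable φ 0 1) :
    Integrable φ normArcLength := by
  have hp := Real.two_pi_pos
  rw [normArcLength]
  refine Integrable.smul_measure ?_ (by simp [Real.pi_pos])
  replace hm := hm.mono_ac arcLength_absolutelyContinuous
  rw [arcLength_eq_map 0] at hm ⊢
  rw [integrable_map_measure hm (measurable_circleMap 0 1).aemeasurable,
    restrict_Ico_eq_restrict_Ioc, zero_add]
  have := (intervalIntegrable_iff_integrableOn_Ioc_of_le hp.le).1 hφ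
  exact this

lemma ae_normArcLength_of_mem_codiscreteWithin {s : Set ℂ}
    (hs : s ∈ codiscreteWithin (Metric.closedBall (0 : ℂ) 1)) : ∀ᵐ z ∂normArcLength, z ∈ s := by
  have hs' : s ∈ codiscreteWithin (Metric.sphere (0 : ℂ) |1|) := by
    rw [abs_one]
    exact codiscreteWithin_mono Metric.sphere_subset_closedBall hs
  have h1 : circleMap 0 1 ⁻¹' s ∈ codiscrete ℝ := circleMap_preimage_codiscrete one_ne_zero hs'
  have h2 : ∀ᵐ t ∂(volume.restrict (Set.Ico 0 (0 + 2 * Real.pi))), circleMap 0 1 t ∈ s :=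
    ae_restrict_le_codiscreteWithin measurableSet_Ico (codiscreteWithin_mono (by tauto) h1)
  refine normArcLength_absolutelyContinuous ?_
  rw [← map_angle_arcLength 0] at h2
  filter_upwards [ae_of_ae_map (measurable_angle 0).aemeasurable h2, ae_arcLength_norm_eq_one]
    with z hz hz1
  rwa [circleMap_angle 0 hz1] at hz

/-- Jensen's formula: the zeros contribute nonnegative terms, and what remains is k log r plus a
constant, with k the order of f at 0. Staying at r ≥ 1/2 bounds k log r from below. -/
lemma exists_le_circleAverage_log_norm {f : ℂ → ℂ}
    (hf : DifferentiableOn ℂ f (Metric.ball 0 1)) :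
    ∃ B : ℝ, ∀ r ∈ Set.Ico (1 / 2 : ℝ) 1,
      B ≤ Real.circleAverage (fun w => Real.log ‖f (r * w)‖) 0 1 := by
  set k : ℝ := ((meromorphicOrderAt f 0).untop₀ : ℝ)
  refine ⟨-|k * Real.log 2| + Real.log ‖meromorphicTrailingCoeffAt f 0‖, fun r hr => ?_⟩
  have hr0 : 0 < r := by linarith [hr.1]
  have hsub : Metric.closedBall (0 : ℂ) |r| ⊆ Metric.ball 0 1 := by
    rw [abs_of_pos hr0]
    exact Metric.closedBall_subset_ball hr.2
  have han : AnalyticOnNhd ℂ f (Metric.closedBall 0 |r|) :=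
    (hf.analyticOnNhd Metric.isOpen_ball).mono hsub
  have h1 := Real.circleAverage_eq_circleAverage_zero_one (f := fun w => Real.log ‖f w‖)
    (c := 0) (R := r)
  simp only [add_zero] at h1
  rw [← h1, han.meromorphicOn.circleAverage_log_norm hr0.ne',
    han.meromorphicOn.divisor_apply (by simp)]
  have h2 : 0 ≤ ∑ᶠ u, (MeromorphicOn.divisor f (Metric.closedBall 0 |r|) u : ℝ) *
      Real.log (r * ‖0 - u‖⁻¹) := by
    refine finsum_nonneg fun u => ?_
    by_cases hu : u ∈ Metric.closedBall (0 : ℂ) |r|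
    · refine mul_nonneg (by exact_mod_cast MeromorphicOn.AnalyticOnNhd.divisor_nonneg han u) ?_
      rcases eq_or_ne u 0 with rfl | hu0
      · simp
      · refine Real.log_nonneg ?_
        have : 0 < ‖u‖ := norm_pos_iff.2 hu0
        rw [zero_sub, norm_neg, ← div_eq_mul_inv, le_div_iff₀ this, one_mul]
        simpa [abs_of_pos hr0] using hu
    · simp [hu]
  have h3 : -|k * Real.log 2| ≤ k * Real.log r := by
    have h4 : |Real.log r| ≤ |Real.log 2| := by
      rw [abs_of_nonpos (Real.log_nonpos hr0.le hr.2.le), abs_of_pos (Real.log_pos one_lt_two),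
        ← Real.log_inv]
      refine Real.log_le_log (by positivity) ?_
      rw [inv_le_comm₀ hr0 two_pos]
      linarith [hr.1]
    refine le_trans ?_ (neg_abs_le _)
    rw [neg_le_neg_iff, abs_mul, abs_mul]
    gcongr
  linarith

lemma log_abs_le_sq (x : ℝ) : Real.log |x| ≤ x ^ 2 := by
  rcases eq_or_ne x 0 with rfl | hx
  · simp
  · have := Real.log_le_sub_one_of_pos (abs_pos.2 hx)
    nlinarith [sq_abs x, sq_nonneg (|x| - 1)]

/-- Jensen's formula bounds the integrals of log⁻|f(r·)| uniformly in r near 1, and Fatou's lemma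
carries the bound to the boundary function. -/
lemma MemHardyTwo.lintegral_negLog_lt_top {f : ℂ → ℂ} (hf : MemHardyTwo f) {z₀ : ℂ}
    (hz₀ : z₀ ∈ Metric.ball (0 : ℂ) 1) (hfz : f z₀ ≠ 0) :
    ∫⁻ w, negLog (boundaryValue f w) ∂normArcLength < ⊤ := by
  have hlim := hf.boundaryValue_spec.1
  obtain ⟨hd, M, hM, hb⟩ := hf
  obtain ⟨B, hB⟩ := exists_le_circleAverage_log_norm hd
  rw [mem_ball_zero_iff] at hz₀
  -- The bound 1/2 is for the estimate from Jensen's formula. The other makes r exceed |z₀|, so that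
  -- f(r·) is nonzero at z₀/r in the closed disc and has a null set of zeros on the circle.
  set r₀ : ℝ := max (1 / 2) ((1 + ‖z₀‖) / 2)
  have hr₀ : r₀ < 1 := max_lt (by norm_num) (by linarith)
  have hbound : ∀ r ∈ Set.Ico r₀ 1, ∫⁻ w, negLog (f (r * w)) ∂normArcLength ≤
      ENNReal.ofReal (-B + M.toReal) := by
    intro r hr
    have hr1 : 1 / 2 ≤ r := (le_max_left _ _).trans hr.1
    have hr2 : (1 + ‖z₀‖) / 2 ≤ r := (le_max_right _ _).trans hr.1
    have hr' : r ∈ Set.Ico (0 : ℝ) 1 := ⟨by linarith, hr.2⟩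
    have hr0 : 0 < r := by linarith
    have hc := (continuousOn_comp_mul hd hr').mono Metric.sphere_subset_closedBall
    have hm := aestronglyMeasurable_of_continuousOn hc
    have han : AnalyticOnNhd ℂ (fun w => f (r * w)) (Metric.closedBall 0 1) := by
      refine (hd.analyticOnNhd Metric.isOpen_ball).comp (t := Metric.ball 0 1)
        (fun w _ => by fun_prop) ?_
      intro w hw
      simp only [Metric.mem_closedBall, dist_zero_right, Metric.mem_ball, norm_mul,
        Complex.norm_real, Real.norm_of_nonneg hr'.1] at hw ⊢
      nlinarith [hr'.1, hr'.2, norm_nonneg w]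
    have hne : ∀ᵐ w ∂normArcLength, f (r * w) ≠ 0 := by
      refine ae_normArcLength_of_mem_codiscreteWithin
        (han.preimage_zero_mem_codiscreteWithin (x := z₀ / r) ?_ ?_ ?_)
      · rwa [mul_div_cancel₀ _ (by exact_mod_cast hr0.ne')]
      · simp only [Metric.mem_closedBall, dist_zero_right, norm_div, Complex.norm_real,
          Real.norm_of_nonneg hr0.le]
        rw [div_le_one hr0]
        linarith
      · exact (convex_closedBall 0 1).isConnected ⟨0, by simp⟩
    have hlogm : AEStronglyMeasurable (fun w => Real.log ‖f (r * w)‖) normArcLength :=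
      (Real.measurable_log.comp_aemeasurable hm.norm.aemeasurable).aestronglyMeasurable
    have hlogi : Integrable (fun w => Real.log ‖f (r * w)‖) normArcLength := by
      refine integrable_normArcLength_of_circleIntegrable hlogm ?_
      refine MeromorphicOn.circleIntegrable_log_norm ?_
      rw [abs_one]
      exact (han.mono Metric.sphere_subset_closedBall).meromorphicOn
    have hlogn : Integrable (fun w => -Real.log ‖f (r * w)‖) normArcLength := hlogi.neg
    have hsqi : Integrable (fun w => ‖f (r * w)‖ ^ 2) normArcLength := by
      have : MemLp (fun w => f (r * w)) 2 normArcLength :=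
        ⟨hm, (eLpNorm_two_le_of_lintegral_sq_le (hb r hr')).trans_lt
          (ENNReal.rpow_lt_top_of_nonneg (by norm_num) hM)⟩
      exact this.integrable_norm_pow (by norm_num)
    have hsq : ∫ w, ‖f (r * w)‖ ^ 2 ∂normArcLength ≤ M.toReal := by
      rw [integral_eq_lintegral_of_nonneg_ae (ae_of_all _ fun w => by positivity) hsqi.1]
      refine ENNReal.toReal_mono hM ((lintegral_congr fun w => ?_).trans_le (hb r hr'))
      rw [ENNReal.ofReal_pow (norm_nonneg _), ofReal_norm]
    -- Since log|f| ≤ |f|², adding |f|² to -log|f| gives a nonnegative majorant of log⁻|f|, whose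
    -- integral is bounded by Jensen's formula and the H² norm.
    calc ∫⁻ w, negLog (f (r * w)) ∂normArcLength
        ≤ ∫⁻ w, ENNReal.ofReal (-Real.log ‖f (r * w)‖ + ‖f (r * w)‖ ^ 2) ∂normArcLength := by
          refine lintegral_mono_ae ?_
          filter_upwards [hne] with w hw
          rw [negLog_of_ne_zero hw]
          exact ENNReal.ofReal_le_ofReal (by linarith [sq_nonneg ‖f (r * w)‖])
      _ = ENNReal.ofReal (∫ w, (-Real.log ‖f (r * w)‖ + ‖f (r * w)‖ ^ 2) ∂normArcLength) := by
          refine (ofReal_integral_eq_lintegral_ofReal (hlogn.add hsqi) ?_).symm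
          refine ae_of_all _ fun w => ?_
          have := log_abs_le_sq ‖f (r * w)‖
          rw [abs_norm] at this
          simp only [Pi.zero_apply, Pi.add_apply]
          linarith
      _ ≤ ENNReal.ofReal (-B + M.toReal) := by
          refine ENNReal.ofReal_le_ofReal ?_
          rw [integral_add hlogn hsqi, integral_neg, integral_normArcLength hlogm]
          have := hB r ⟨hr1, hr.2⟩
          linarith
  set ρ : ℕ → ℝ := fun n => 1 - (1 - r₀) / (n + 1)
  have hρ : ∀ n, ρ n ∈ Set.Ico r₀ 1 := by
    intro n
    have h1 : (1 : ℝ) ≤ n + 1 := by linarith [n.cast_nonneg (α := ℝ)]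
    have h2 : 0 < (1 - r₀) / ((n : ℝ) + 1) := div_pos (by linarith) (by linarith)
    have h3 : (1 - r₀) / ((n : ℝ) + 1) ≤ 1 - r₀ := div_le_self (by linarith) h1
    constructor <;> simp only [ρ] <;> linarith
  have hρlim : Tendsto ρ atTop (𝓝[<] 1) := by
    refine tendsto_nhdsWithin_iff.2 ⟨?_, Eventually.of_forall fun n => (hρ n).2⟩
    have h1 : Tendsto (fun n : ℕ => (1 - r₀) * (1 / ((n : ℝ) + 1))) atTop (𝓝 ((1 - r₀) * 0)) :=
      tendsto_one_div_add_atTop_nhds_zero_nat.const_mul _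
    have h2 := h1.const_sub 1
    rw [mul_zero, sub_zero] at h2
    refine h2.congr fun n => ?_
    simp only [ρ]
    ring
  calc ∫⁻ w, negLog (boundaryValue f w) ∂normArcLength
      ≤ ∫⁻ w, liminf (fun n => negLog (f (ρ n * w))) atTop ∂normArcLength := by
        refine lintegral_mono_ae ?_
        filter_upwards [hlim] with w hw
        have h1 : Tendsto (fun n => f (ρ n * w)) atTop (𝓝 (boundaryValue f w)) := hw.comp hρlim
        exact ((continuous_negLog.tendsto _).comp h1).liminf_eq.ge
    _ ≤ liminf (fun n => ∫⁻ w, negLog (f (ρ n * w)) ∂normArcLength) atTop := by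
        refine lintegral_liminf_le' fun n => ?_
        have hc := (continuousOn_comp_mul hd ⟨(by norm_num : (0 : ℝ) ≤ 1 / 2).trans
          ((le_max_left _ _).trans (hρ n).1), (hρ n).2⟩).mono Metric.sphere_subset_closedBall
        exact continuous_negLog.measurable.comp_aemeasurable
          (aestronglyMeasurable_of_continuousOn hc).aemeasurable
    _ ≤ ENNReal.ofReal (-B + M.toReal) := by
        refine liminf_le_of_le (by isBoundedDefault) fun b hb => ?_
        obtain ⟨n, hn⟩ := hb.exists
        exact hn.trans (hbound _ (hρ n))
    _ < ⊤ := ENNReal.ofReal_lt_top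

/-! ### Dyadic subdivision of an arc and sums over scales. -/

section

/-- The open arc `{e^{it} : a < t < a + l}`, for `l ≤ 2π`. -/
def arc (a l : ℝ) : Set ℂ := {z | ‖z‖ = 1 ∧ angle a z ∈ Set.Ioo a (a + l)}

/-- The position of `z` in the division of `arc a l` into `2 ^ k` arcs of equal length. -/
noncomputable def dyadicIndex (a l : ℝ) (k : ℕ) (z : ℂ) : ℕ :=
  ⌊2 ^ k * ((angle a z - a) / l)⌋₊

/-- The `i`-th of the `2 ^ k` subarcs of `arc a l`. -/
def dyadicArc (a l : ℝ) (k i : ℕ) : Set ℂ := {z | z ∈ arc a l ∧ dyadicIndex a l k z = i}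

variable {a l : ℝ} {k i : ℕ} {z w : ℂ}

lemma measurableSet_arc : MeasurableSet (arc a l) :=
  measurableSet_angle_preimage a measurableSet_Ioo

lemma measurable_dyadicIndex : Measurable (dyadicIndex a l k) := by
  unfold dyadicIndex
  have := measurable_angle a
  exact Nat.measurable_floor.comp (by fun_prop)

lemma measurableSet_dyadicArc : MeasurableSet (dyadicArc a l k i) :=
  measurableSet_arc.inter (measurable_dyadicIndex (measurableSet_singleton i))

lemma dyadicArc_subset_arc : dyadicArc a l k i ⊆ arc a l := fun _ h => h.1

lemma dyadicIndex_lt (hl : 0 < l) (hz : z ∈ arc a l) : dyadicIndex a l k z < 2 ^ k := by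
  have h1 : 0 < angle a z - a := sub_pos.2 hz.2.1
  have h2 : angle a z - a < l := by linarith [hz.2.2]
  unfold dyadicIndex
  rw [Nat.floor_lt (by positivity)]
  push_cast
  have : (angle a z - a) / l < 1 := by rwa [div_lt_one hl]
  have h3 : (0 : ℝ) < 2 ^ k := by positivity
  nlinarith

/-- Identifies the parent of the i-th subarc as the one of index `i / 2`. -/
lemma dyadicIndex_succ_div_two : dyadicIndex a l (k + 1) z / 2 = dyadicIndex a l k z := by
  unfold dyadicIndex
  have h := Nat.floor_div_natCast (2 ^ (k + 1) * ((angle a z - a) / l)) 2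
  rw [← h]
  congr 1
  push_cast
  ring

lemma dyadicArc_zero (hl : 0 < l) : dyadicArc a l 0 0 = arc a l := by
  ext z
  refine ⟨fun h => h.1, fun h => ⟨h, ?_⟩⟩
  have := dyadicIndex_lt (k := 0) hl h
  omega

lemma abs_angle_sub_lt (hl : 0 < l) (hz : z ∈ dyadicArc a l k i) (hw : w ∈ dyadicArc a l k i) :
    |angle a z - angle a w| < l / 2 ^ k := by
  have key : ∀ {x : ℂ}, x ∈ dyadicArc a l k i →
      (i : ℝ) * (l / 2 ^ k) ≤ angle a x - a ∧ angle a x - a < (i + 1) * (l / 2 ^ k) := by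
    rintro x ⟨hx, hi⟩
    have h1 : 0 < angle a x - a := sub_pos.2 hx.2.1
    unfold dyadicIndex at hi
    rw [Nat.floor_eq_iff (by positivity)] at hi
    constructor
    · calc (i : ℝ) * (l / 2 ^ k) ≤ 2 ^ k * ((angle a x - a) / l) * (l / 2 ^ k) := by
            gcongr; exact hi.1
        _ = _ := by field_simp
    · calc angle a x - a = 2 ^ k * ((angle a x - a) / l) * (l / 2 ^ k) := by field_simp
        _ < _ := by gcongr; exact hi.2
  have h1 := key hz
  have h2 := key hw
  rw [abs_lt]
  constructor <;> nlinarith [h1.1, h1.2, h2.1, h2.2]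

lemma norm_sub_lt_of_mem_dyadicArc (hl : 0 < l) (hz : z ∈ dyadicArc a l k i)
    (hw : w ∈ dyadicArc a l k i) : ‖z - w‖ < l / 2 ^ k :=
  (norm_sub_le_abs_angle_sub a hz.1.1 hw.1.1).trans_lt (abs_angle_sub_lt hl hz hw)

lemma arcLength_dyadicArc (hl : 0 < l) (hl' : l ≤ 2 * Real.pi) (hi : i < 2 ^ k) :
    arcLength (dyadicArc a l k i) = ENNReal.ofReal (l / 2 ^ k) := by
  have h2 : (0 : ℝ) < 2 ^ k := by positivity
  have hρ : 0 < l / 2 ^ k := by positivity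
  have hi1 : ((i : ℝ) + 1) * (l / 2 ^ k) ≤ l := by
    have : (i : ℝ) + 1 ≤ 2 ^ k := by exact_mod_cast hi
    calc ((i : ℝ) + 1) * (l / 2 ^ k) ≤ 2 ^ k * (l / 2 ^ k) := by gcongr
      _ = l := by field_simp
  have hmem : ∀ t : ℝ, a ≤ t → (⌊2 ^ k * ((t - a) / l)⌋₊ = i ↔
      t ∈ Set.Ico (a + i * (l / 2 ^ k)) (a + (i + 1) * (l / 2 ^ k))) := by
    intro t ht
    have h0 : 0 ≤ t - a := by linarith
    rw [Nat.floor_eq_iff (by positivity), Set.mem_Ico]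
    have e : 2 ^ k * ((t - a) / l) = (t - a) / (l / 2 ^ k) := by field_simp
    rw [e, le_div_iff₀ hρ, div_lt_iff₀ hρ]
    constructor <;> rintro ⟨h3, h4⟩ <;> constructor <;> linarith
  have hset : dyadicArc a l k i = {z | ‖z‖ = 1 ∧ angle a z ∈
      Set.Ioo a (a + l) ∩ Set.Ico (a + i * (l / 2 ^ k)) (a + (i + 1) * (l / 2 ^ k))} := by
    ext z
    constructor
    · rintro ⟨hz, hi⟩
      exact ⟨hz.1, hz.2, (hmem _ hz.2.1.le).1 hi⟩
    · rintro ⟨hz, hz1, hz2⟩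
      exact ⟨⟨hz, hz1⟩, (hmem _ hz1.1.le).2 hz2⟩
  have hiρ : 0 ≤ (i : ℝ) * (l / 2 ^ k) := by positivity
  rw [hset, arcLength_angle_preimage a (measurableSet_Ioo.inter measurableSet_Ico)]
  refine le_antisymm ?_ ?_
  · calc _ ≤ volume (Set.Ico (a + i * (l / 2 ^ k)) (a + (i + 1) * (l / 2 ^ k))) :=
          measure_mono fun t ht => ht.1.2
      _ = _ := by rw [Real.volume_Ico]; ring_nf
  · calc ENNReal.ofReal (l / 2 ^ k)
        = volume (Set.Ioo (a + i * (l / 2 ^ k)) (a + (i + 1) * (l / 2 ^ k))) := by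
          rw [Real.volume_Ioo]; ring_nf
      _ ≤ _ := by
          refine measure_mono fun t ht => ?_
          have := ht.1
          have := ht.2
          exact ⟨⟨⟨by linarith, by linarith⟩, ht.1.le, ht.2⟩, by linarith, by linarith⟩

lemma arcLength_arc (hl : 0 < l) (hl' : l ≤ 2 * Real.pi) :
    arcLength (arc a l) = ENNReal.ofReal l := by
  rw [← dyadicArc_zero hl, arcLength_dyadicArc hl hl' (by simp)]
  simp

lemma arc_eq_biUnion (hl : 0 < l) (k : ℕ) :
    arc a l = ⋃ i ∈ Finset.range (2 ^ k), dyadicArc a l k i := by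
  ext z
  simp only [Finset.mem_range, Set.mem_iUnion, exists_prop]
  exact ⟨fun hz => ⟨_, dyadicIndex_lt hl hz, hz, rfl⟩, fun ⟨_, _, hz⟩ => hz.1⟩

lemma pairwiseDisjoint_dyadicArc (s : Set ℕ) : s.PairwiseDisjoint (dyadicArc a l k) := by
  intro i _ j _ hij
  refine Set.disjoint_left.2 fun z hz hz' => hij ?_
  rw [← hz.2, ← hz'.2]

lemma setLIntegral_arc_eq_sum (hl : 0 < l) (k : ℕ) (μ : Measure ℂ) (F : ℂ → ℝ≥0∞) :
    ∫⁻ z in arc a l, F z ∂μ =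
      ∑ i ∈ Finset.range (2 ^ k), ∫⁻ z in dyadicArc a l k i, F z ∂μ := by
  conv_lhs => rw [arc_eq_biUnion hl k]
  exact lintegral_biUnion_finset (pairwiseDisjoint_dyadicArc _)
    (fun i _ => measurableSet_dyadicArc) _

lemma setLIntegral_dyadicIndex (hl : 0 < l) (k : ℕ) (μ : Measure ℂ) (F : ℕ → ℝ≥0∞) :
    ∫⁻ z in arc a l, F (dyadicIndex a l k z) ∂μ =
      ∑ i ∈ Finset.range (2 ^ k), F i * μ (dyadicArc a l k i) := by
  rw [setLIntegral_arc_eq_sum hl k]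
  refine Finset.sum_congr rfl fun i _ => ?_
  rw [← setLIntegral_const]
  exact setLIntegral_congr_fun measurableSet_dyadicArc fun z hz => by rw [hz.2]

/-- A geometric sum over the scales `l / 2 ^ k` larger than `x`. -/
lemma sum_scale_rpow_neg_le (hl : 0 < l) {p x : ℝ} (hp : 0 < p) (hx : 0 < x) (N : ℕ) :
    ∑ k ∈ Finset.range N, (if x < l / 2 ^ k then (l / 2 ^ k) ^ (-p) else 0) ≤
      (1 - 2 ^ (-p))⁻¹ * x ^ (-p) := by
  have hc : 0 < 1 - (2 : ℝ) ^ (-p) :=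
    sub_pos.2 (Real.rpow_lt_one_of_one_lt_of_neg one_lt_two (neg_lt_zero.2 hp))
  have hρ : ∀ k : ℕ, 0 < l / 2 ^ k := fun k => by positivity
  have hrec : ∀ k : ℕ, 2 ^ (-p) * (l / 2 ^ (k + 1)) ^ (-p) = (l / 2 ^ k) ^ (-p) := by
    intro k
    rw [← Real.mul_rpow two_pos.le (hρ _).le]
    congr 1
    rw [pow_succ]
    field_simp
  -- The induction also needs the first bound in the minimum, which is (l/2^(N-1))^{-p}, the size of
  -- the last summand: it absorbs each new term, and is exchanged for x^{-p} when the new scale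
  -- exceeds x.
  suffices h : (1 - 2 ^ (-p)) *
      ∑ k ∈ Finset.range N, (if x < l / 2 ^ k then (l / 2 ^ k) ^ (-p) else 0) ≤
        min (2 ^ (-p) * (l / 2 ^ N) ^ (-p)) (x ^ (-p)) by
    rw [inv_mul_eq_div, le_div_iff₀' hc]
    exact h.trans (min_le_right _ _)
  induction N with
  | zero =>
    simp only [Finset.range_zero, Finset.sum_empty, mul_zero]
    have := hρ 0
    exact le_min (by positivity) (by positivity)
  | succ N ih =>
    rw [Finset.sum_range_succ, mul_add, hrec]
    split_ifs with h
    · have h1 : (1 - (2 : ℝ) ^ (-p)) *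
          ∑ k ∈ Finset.range N, (if x < l / 2 ^ k then (l / 2 ^ k) ^ (-p) else 0) +
          (1 - 2 ^ (-p)) * (l / 2 ^ N) ^ (-p) ≤ (l / 2 ^ N) ^ (-p) := by
        linarith [ih.trans (min_le_left _ _)]
      exact le_min h1 (h1.trans (Real.rpow_le_rpow_of_nonpos hx h.le (by linarith)))
    · rw [mul_zero, add_zero]
      refine le_min ((ih.trans (min_le_left _ _)).trans ?_) (ih.trans (min_le_right _ _))
      rw [← hrec N]
      have h2 : (2 : ℝ) ^ (-p) ≤ 1 := by linarith
      have := hρ (N + 1)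
      exact mul_le_of_le_one_left (by positivity) h2

/-- A count of scales: as l ≤ 2π < 8, x < l/2^(N+4) forces x < 2^{-(N+1)}, hence N + 1 ≤ |log x|/log
2. The shift by 4 is needed because |log x| vanishes at x = 1 and cannot dominate the coarsest
scales. -/
lemma sum_scale_one_le (hl : l ≤ 2 * Real.pi) {x : ℝ} (hx : 0 < x) (N : ℕ) :
    ∑ k ∈ Finset.range N, (if x < l / 2 ^ (k + 4) then (1 : ℝ) else 0) ≤
      (Real.log 2)⁻¹ * |Real.log x| := by
  have h2 := Real.log_pos one_lt_two
  induction N with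
  | zero => simp; positivity
  | succ N ih =>
    rw [Finset.sum_range_succ]
    split_ifs with h
    · have h3 : ∑ k ∈ Finset.range N, (if x < l / 2 ^ (k + 4) then (1 : ℝ) else 0) ≤ N := by
        calc _ ≤ ∑ k ∈ Finset.range N, (1 : ℝ) :=
              Finset.sum_le_sum fun k _ => by split_ifs <;> norm_num
          _ = N := by simp
      have h4 : x ≤ (2 ^ (N + 1))⁻¹ := by
        refine h.le.trans ?_
        rw [div_le_iff₀ (by positivity)]
        have h5 : ((2 : ℝ) ^ (N + 1))⁻¹ * 2 ^ (N + 4) = 8 := by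
          rw [pow_add, pow_add]
          field_simp
          norm_num
        rw [h5]
        linarith [Real.pi_lt_d2]
      have h6 := Real.log_le_log hx h4
      rw [Real.log_inv, Real.log_pow] at h6
      push_cast at h6
      rw [inv_mul_eq_div, le_div_iff₀ h2]
      have := neg_le_abs (Real.log x)
      nlinarith
    · linarith

end

/-! ### Comparison of the dyadic energy with the kernel energy. -/

section

variable {a l : ℝ} {k i : ℕ}

/-- The contribution of the scale `l / 2 ^ k` to the discretized `(1 - β)`-energy of `μ`. -/
noncomputable def dyadicEnergy (β a l : ℝ) (μ : Measure ℂ) (k : ℕ) : ℝ≥0∞ :=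
  ENNReal.ofReal ((l / 2 ^ k) ^ (β - 1)) *
    ∑ i ∈ Finset.range (2 ^ k), μ (dyadicArc a l k i) ^ 2

lemma norm_one_sub_mul_conj {z w : ℂ} (hw : ‖w‖ = 1) :
    ‖1 - z * (starRingEnd ℂ) w‖ = ‖z - w‖ := by
  have h : (w - z) * (starRingEnd ℂ) w = 1 - z * (starRingEnd ℂ) w := by
    rw [sub_mul, Complex.mul_conj, Complex.normSq_eq_norm_sq, hw]
    simp
  rw [← h, norm_mul, RCLike.norm_conj, hw, mul_one, norm_sub_rev]

/-- The sum of squares is the μ × μ mass of the pairs lying in a common subarc, so a pointwise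
comparison of kernels is enough. The shift m serves the logarithmic case. -/
lemma tsum_sq_dyadicArc_le_energy (hl : 0 < l) {μ : Measure ℂ} (hμ : μ (arc a l)ᶜ = 0) {s C : ℝ}
    (m : ℕ) (c : ℕ → ℝ≥0∞)
    (hc : ∀ z ∈ arc a l, ∀ w ∈ arc a l,
      ∑' k, c k * (dyadicArc a l (k + m) (dyadicIndex a l (k + m) z)).indicator 1 w ≤
        ENNReal.ofReal C * kernel s (z * (starRingEnd ℂ) w)) :
    ∑' k, c k * ∑ i ∈ Finset.range (2 ^ (k + m)), μ (dyadicArc a l (k + m) i) ^ 2 ≤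
      ENNReal.ofReal C * energy s μ := by
  have hae : ∀ᵐ z ∂μ, z ∈ arc a l := by rwa [ae_iff]
  have hr : μ.restrict (arc a l) = μ := Measure.restrict_eq_self_of_ae_mem hae
  calc ∑' k, c k * ∑ i ∈ Finset.range (2 ^ (k + m)), μ (dyadicArc a l (k + m) i) ^ 2
      = ∑' k, ∫⁻ z, c k * μ (dyadicArc a l (k + m) (dyadicIndex a l (k + m) z)) ∂μ := by
        refine tsum_congr fun k => ?_
        rw [lintegral_const_mul]
        · have h := setLIntegral_dyadicIndex (a := a) hl (k + m) μ
            (fun i => μ (dyadicArc a l (k + m) i))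
          rw [hr] at h
          rw [h]
          simp_rw [sq]
        · exact (measurable_from_nat (f := fun i => μ (dyadicArc a l (k + m) i))).comp
            measurable_dyadicIndex
    _ = ∫⁻ z, ∫⁻ w, ∑' k, c k *
          (dyadicArc a l (k + m) (dyadicIndex a l (k + m) z)).indicator 1 w ∂μ ∂μ := by
        rw [← lintegral_tsum]
        · refine lintegral_congr fun z => ?_
          rw [lintegral_tsum]
          · refine tsum_congr fun k => ?_
            rw [lintegral_const_mul _ (measurable_one.indicator measurableSet_dyadicArc),
              lintegral_indicator_one measurableSet_dyadicArc]
          · intro k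
            exact ((measurable_one.indicator measurableSet_dyadicArc).const_mul _).aemeasurable
        · intro k
          exact (((measurable_from_nat (f := fun i => μ (dyadicArc a l (k + m) i))).comp
            measurable_dyadicIndex).const_mul _).aemeasurable
    _ ≤ ∫⁻ z, ∫⁻ w, ENNReal.ofReal C * kernel s (z * (starRingEnd ℂ) w) ∂μ ∂μ := by
        refine lintegral_mono_ae ?_
        filter_upwards [hae] with z hz
        refine lintegral_mono_ae ?_
        filter_upwards [hae] with w hw
        exact hc z hz w hw
    _ = ENNReal.ofReal C * energy s μ := by
        simp_rw [lintegral_const_mul' _ _ ENNReal.ofReal_ne_top]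
        rfl

lemma tsum_mul_indicator_dyadicArc_le (hl : 0 < l) {z w : ℂ} (hz : z ∈ arc a l)
    {m : ℕ} {c : ℕ → ℝ} {B : ℝ}
    (hc : ∀ k, 0 ≤ c k)
    (hB : ∀ N, ∑ k ∈ Finset.range N, (if ‖z - w‖ < l / 2 ^ (k + m) then c k else 0) ≤ B) :
    ∑' k, ENNReal.ofReal (c k) *
      (dyadicArc a l (k + m) (dyadicIndex a l (k + m) z)).indicator 1 w ≤ ENNReal.ofReal B := by
  refine ENNReal.tsum_le_of_sum_range_le fun N => ?_
  refine le_trans ?_ (ENNReal.ofReal_le_ofReal (hB N))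
  rw [ENNReal.ofReal_sum_of_nonneg fun k _ => by split_ifs <;> simp [hc]]
  refine Finset.sum_le_sum fun k _ => ?_
  by_cases hw : w ∈ dyadicArc a l (k + m) (dyadicIndex a l (k + m) z)
  · rw [Set.indicator_of_mem hw, if_pos (norm_sub_lt_of_mem_dyadicArc hl ⟨hz, rfl⟩ hw)]
    simp
  · simp [hw]

lemma kernel_eq_top {z : ℂ} (hz : ‖z‖ = 1) {s : ℝ} (hs : 0 ≤ s) :
    kernel s (z * (starRingEnd ℂ) z) = ⊤ := by
  have h : z * (starRingEnd ℂ) z = 1 := by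
    rw [Complex.mul_conj, Complex.normSq_eq_norm_sq, hz]; simp
  rw [h, kernel]
  rcases eq_or_ne s 0 with h0 | h0
  · simp [h0]
  · rw [if_neg h0]
    have : 0 < s := lt_of_le_of_ne hs (Ne.symm h0)
    simp [this]

lemma tsum_dyadicEnergy_le_of_lt_one {β : ℝ} (hβ1 : β < 1) (hl : 0 < l)
    {μ : Measure ℂ} (hμ : μ (arc a l)ᶜ = 0) :
    ∑' k, dyadicEnergy β a l μ k ≤
      ENNReal.ofReal (1 - 2 ^ (-(1 - β)))⁻¹ * energy (1 - β) μ := by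
  have hc : 0 < 1 - (2 : ℝ) ^ (-(1 - β)) :=
    sub_pos.2 (Real.rpow_lt_one_of_one_lt_of_neg one_lt_two (by linarith))
  refine tsum_sq_dyadicArc_le_energy hl hμ 0
    (fun k => ENNReal.ofReal ((l / 2 ^ k) ^ (β - 1))) fun z hz w hw => ?_
  rcases eq_or_ne z w with rfl | hzw
  · rw [kernel_eq_top hz.1 (by linarith), ENNReal.mul_top (by simpa using hc)]
    exact le_top
  · have hd : 0 < ‖z - w‖ := norm_pos_iff.2 (sub_ne_zero.2 hzw)
    have hk : kernel (1 - β) (z * (starRingEnd ℂ) w) = ENNReal.ofReal (‖z - w‖ ^ (-(1 - β))) := by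
      rw [kernel, if_neg (by linarith), ← ofReal_norm, norm_one_sub_mul_conj hw.1,
        ENNReal.ofReal_rpow_of_pos hd]
    rw [hk, ← ENNReal.ofReal_mul (by positivity)]
    refine tsum_mul_indicator_dyadicArc_le hl hz (fun k => by positivity) fun N => ?_
    simp only [add_zero]
    have := sum_scale_rpow_neg_le hl (p := 1 - β) (by linarith) hd N
    rwa [neg_sub] at this ⊢

lemma tsum_dyadicEnergy_add_four_le (hl : 0 < l) (hl' : l ≤ 2 * Real.pi)
    {μ : Measure ℂ} (hμ : μ (arc a l)ᶜ = 0) :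
    ∑' k, dyadicEnergy 1 a l μ (k + 4) ≤ ENNReal.ofReal (Real.log 2)⁻¹ * energy 0 μ := by
  have h2 := Real.log_pos one_lt_two
  have key := tsum_sq_dyadicArc_le_energy hl hμ (s := 0) (C := (Real.log 2)⁻¹) 4
    (fun k => ENNReal.ofReal 1) fun z hz w hw => ?_
  · refine le_trans (le_of_eq (tsum_congr fun k => ?_)) key
    rw [dyadicEnergy, sub_self, Real.rpow_zero]
  · rcases eq_or_ne z w with rfl | hzw
    · rw [kernel_eq_top hz.1 le_rfl, ENNReal.mul_top (by simpa using h2)]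
      exact le_top
    · have hd : 0 < ‖z - w‖ := norm_pos_iff.2 (sub_ne_zero.2 hzw)
      have h1 : z * (starRingEnd ℂ) w ≠ 1 := by
        intro h
        have := norm_one_sub_mul_conj (z := z) hw.1
        rw [h, sub_self, norm_zero] at this
        exact hd.ne this
      rw [kernel, if_pos rfl, if_neg h1, norm_one_sub_mul_conj hw.1,
        ← ENNReal.ofReal_mul (by positivity)]
      exact tsum_mul_indicator_dyadicArc_le hl hz (fun k => zero_le_one)
        fun N => sum_scale_one_le hl' hd N

lemma sum_dyadicArc (hl : 0 < l) {μ : Measure ℂ} [IsProbabilityMeasure μ]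
    (hμ : μ (arc a l)ᶜ = 0) (k : ℕ) :
    ∑ i ∈ Finset.range (2 ^ k), μ (dyadicArc a l k i) = 1 := by
  have h := setLIntegral_dyadicIndex (a := a) hl k μ (fun _ => 1)
  simp only [lintegral_const, one_mul, Measure.restrict_apply_univ] at h
  rw [← h]
  exact (prob_compl_eq_zero_iff measurableSet_arc).1 hμ

lemma sq_sum_mul_le {ι : Type*} (s : Finset ι) (f g : ι → ℝ≥0∞) :
    (∑ i ∈ s, f i * g i) ^ 2 ≤ (∑ i ∈ s, f i ^ 2) * ∑ i ∈ s, g i ^ 2 := by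
  have h := ENNReal.inner_le_Lp_mul_Lq s f g (p := 2) (q := 2)
    (by norm_num [Real.holderConjugate_iff])
  calc (∑ i ∈ s, f i * g i) ^ 2
      ≤ ((∑ i ∈ s, f i ^ (2 : ℝ)) ^ (1 / 2 : ℝ) * (∑ i ∈ s, g i ^ (2 : ℝ)) ^ (1 / 2 : ℝ)) ^ 2 := by
        gcongr
    _ = _ := by
      rw [mul_pow, ← ENNReal.rpow_natCast, ← ENNReal.rpow_natCast, ← ENNReal.rpow_mul,
        ← ENNReal.rpow_mul]
      norm_num

/-- Cauchy–Schwarz over 2^k subarcs of total mass 1. -/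
lemma one_le_dyadicEnergy (hl : 0 < l) {μ : Measure ℂ} [IsProbabilityMeasure μ]
    (hμ : μ (arc a l)ᶜ = 0) (k : ℕ) : 1 ≤ 2 ^ k * dyadicEnergy 1 a l μ k := by
  have h := sq_sum_mul_le (Finset.range (2 ^ k)) (fun _ => 1)
    (fun i => μ (dyadicArc a l k i))
  simp only [one_mul, sum_dyadicArc hl hμ k, one_pow, Finset.sum_const, Finset.card_range,
    nsmul_eq_mul, mul_one] at h
  simpa [dyadicEnergy] using h

lemma dyadicEnergy_one_le_one (hl : 0 < l) {μ : Measure ℂ} [IsProbabilityMeasure μ]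
    (hμ : μ (arc a l)ᶜ = 0) (k : ℕ) : dyadicEnergy 1 a l μ k ≤ 1 := by
  rw [dyadicEnergy, sub_self, Real.rpow_zero, ENNReal.ofReal_one, one_mul,
    ← sum_dyadicArc hl hμ k]
  refine Finset.sum_le_sum fun i _ => ?_
  rw [sq]
  exact mul_le_of_le_one_left zero_le prob_le_one

/-- The constant does not depend on the arc. For β < 1 the kernel comparison covers all scales. For
β = 1 the four coarsest terms are at most 1 each, and 1 is at most 16 times the term at k = 4,
whence 4 · 16 + 1 = 65. -/
lemma exists_tsum_dyadicEnergy_le {β : ℝ} (hβ1 : β ≤ 1) :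
    ∃ C : ℝ, 0 < C ∧ ∀ (a l : ℝ), 0 < l → l ≤ 2 * Real.pi → ∀ μ : Measure ℂ,
      IsProbabilityMeasure μ → μ (arc a l)ᶜ = 0 →
      ∑' k, dyadicEnergy β a l μ k ≤ ENNReal.ofReal C * energy (1 - β) μ := by
  rcases hβ1.lt_or_eq with hβ1 | rfl
  · refine ⟨_, ?_, fun a l hl _ μ _ hμ => tsum_dyadicEnergy_le_of_lt_one hβ1 hl hμ⟩
    have : 0 < 1 - (2 : ℝ) ^ (-(1 - β)) :=
      sub_pos.2 (Real.rpow_lt_one_of_one_lt_of_neg one_lt_two (by linarith))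
    positivity
  · have h2 := Real.log_pos one_lt_two
    refine ⟨65 * (Real.log 2)⁻¹, by positivity, fun a l hl hl' μ _ hμ => ?_⟩
    have h4 := tsum_dyadicEnergy_add_four_le hl hl' hμ
    rw [← ENNReal.summable.sum_add_tsum_nat_add' (k := 4), sub_self]
    calc _ ≤ ∑ k ∈ Finset.range 4, (1 : ℝ≥0∞) + ∑' k, dyadicEnergy 1 a l μ (k + 4) := by
          gcongr
          exact dyadicEnergy_one_le_one hl hμ _
      _ = 4 * 1 + ∑' k, dyadicEnergy 1 a l μ (k + 4) := by simp
      _ ≤ 4 * (2 ^ 4 * ∑' k, dyadicEnergy 1 a l μ (k + 4)) +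
            ∑' k, dyadicEnergy 1 a l μ (k + 4) := by
          gcongr
          refine (one_le_dyadicEnergy hl hμ 4).trans ?_
          gcongr
          exact ENNReal.le_tsum (f := fun k => dyadicEnergy 1 a l μ (k + 4)) 0
      _ = 65 * ∑' k, dyadicEnergy 1 a l μ (k + 4) := by ring
      _ ≤ 65 * (ENNReal.ofReal (Real.log 2)⁻¹ * energy 0 μ) := by gcongr
      _ = _ := by
          rw [ENNReal.ofReal_mul (by norm_num), mul_assoc]
          norm_num

end

/-! ### Oscillation of dyadic means. -/

section

variable {a l β : ℝ} {k i : ℕ} {u : ℂ → ℂ}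

/-- Superadditivity of the lower integral, valid without measurability; this direction suffices here
and spares measurability proofs for iterated integrals. -/
lemma sum_lintegral_le_lintegral_sum {X ι : Type*} [MeasurableSpace X] (μ : Measure X)
    (s : Finset ι) (F : ι → X → ℝ≥0∞) :
    ∑ i ∈ s, ∫⁻ x, F i x ∂μ ≤ ∫⁻ x, ∑ i ∈ s, F i x ∂μ := by
  classical
  induction s using Finset.induction_on with
  | empty => simp
  | insert i s hi ih =>
    simp only [Finset.sum_insert hi]
    exact (add_le_add_right ih _).trans (le_lintegral_add _ _)

lemma sq_rpow_half (x : ℝ≥0∞) : (x ^ (1 / 2 : ℝ)) ^ 2 = x := by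
  rw [← ENNReal.rpow_natCast, ← ENNReal.rpow_mul]
  norm_num

lemma le_rpow_half_of_sq_le {x y : ℝ≥0∞} (h : x ^ 2 ≤ y) : x ≤ y ^ (1 / 2 : ℝ) := by
  refine le_trans (le_of_eq ?_) (ENNReal.rpow_le_rpow h (by norm_num))
  rw [← ENNReal.rpow_natCast, ← ENNReal.rpow_mul]
  norm_num

lemma enorm_sq_le_two_mul (x y : ℂ) : ‖x‖ₑ ^ 2 ≤ 2 * ‖x - y‖ₑ ^ 2 + 2 * ‖y‖ₑ ^ 2 := by
  have h1 : ‖x‖ₑ ≤ ‖x - y‖ₑ + ‖y‖ₑ := by simpa using enorm_add_le (x - y) y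
  have h2 := ENNReal.rpow_add_le_mul_rpow_add_rpow ‖x - y‖ₑ ‖y‖ₑ (p := 2) (by norm_num)
  norm_num at h2
  rw [← mul_add]
  exact (by gcongr : ‖x‖ₑ ^ 2 ≤ (‖x - y‖ₑ + ‖y‖ₑ) ^ 2).trans h2

lemma sq_lintegral_le {X : Type*} [MeasurableSpace X] {P : Measure X} [IsProbabilityMeasure P]
    {h : X → ℝ≥0∞} (hh : AEMeasurable h P) : (∫⁻ x, h x ∂P) ^ 2 ≤ ∫⁻ x, h x ^ 2 ∂P := by
  have h1 := ENNReal.lintegral_mul_le_Lp_mul_Lq P (p := 2) (q := 2)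
    (by norm_num [Real.holderConjugate_iff]) hh (aemeasurable_const (b := (1 : ℝ≥0∞)))
  simp only [Pi.mul_apply, mul_one, ENNReal.rpow_ofNat, one_pow,
    lintegral_one, measure_univ, ENNReal.one_rpow] at h1
  calc (∫⁻ x, h x ∂P) ^ 2 ≤ ((∫⁻ x, h x ^ 2 ∂P) ^ (1 / 2 : ℝ)) ^ 2 := by gcongr
    _ = _ := sq_rpow_half _

lemma sq_enorm_integral_sub_le {X : Type*} [MeasurableSpace X] {P : Measure X}
    [IsProbabilityMeasure P] {v : X → ℂ} (hv : Integrable v P) (c : ℂ) :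
    ‖(∫ x, v x ∂P) - c‖ₑ ^ 2 ≤ ∫⁻ x, ‖v x - c‖ₑ ^ 2 ∂P := by
  have h1 : (∫ x, v x ∂P) - c = ∫ x, (v x - c) ∂P := by
    rw [integral_sub hv (integrable_const c)]
    simp
  rw [h1]
  refine le_trans (by gcongr; exact enorm_integral_le_lintegral_enorm _) (sq_lintegral_le ?_)
  exact (hv.1.sub aestronglyMeasurable_const).enorm

lemma sq_enorm_sub_integral_le {X : Type*} [MeasurableSpace X] {P : Measure X}
    [IsProbabilityMeasure P] {v : X → ℂ} (hv : Integrable v P) (c : ℂ) :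
    ‖c - ∫ x, v x ∂P‖ₑ ^ 2 ≤ ∫⁻ x, ‖c - v x‖ₑ ^ 2 ∂P := by
  simp_rw [enorm_sub_rev c]
  exact sq_enorm_integral_sub_le hv c

lemma sq_enorm_integral_sub_integral_le {X : Type*} [MeasurableSpace X] {P Q : Measure X}
    [IsProbabilityMeasure P] [IsProbabilityMeasure Q] {v : X → ℂ} (hP : Integrable v P)
    (hQ : Integrable v Q) :
    ‖(∫ x, v x ∂P) - ∫ x, v x ∂Q‖ₑ ^ 2 ≤ ∫⁻ x, ∫⁻ y, ‖v x - v y‖ₑ ^ 2 ∂Q ∂P :=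
  (sq_enorm_integral_sub_le hP _).trans
    (lintegral_mono fun x => sq_enorm_sub_integral_le hQ (v x))

/-- Normalized arc length on the subarc `dyadicArc a l k i`. -/
noncomputable def dyadicMeasure (a l : ℝ) (k i : ℕ) : Measure ℂ :=
  (ENNReal.ofReal (l / 2 ^ k))⁻¹ • arcLength.restrict (dyadicArc a l k i)

/-- The mean value of `u` on the subarc `dyadicArc a l k i`. -/
noncomputable def dyadicMean (u : ℂ → ℂ) (a l : ℝ) (k i : ℕ) : ℂ :=
  ∫ x, u x ∂dyadicMeasure a l k i

lemma isProbabilityMeasure_dyadicMeasure (hl : 0 < l) (hl' : l ≤ 2 * Real.pi) (hi : i < 2 ^ k) :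
    IsProbabilityMeasure (dyadicMeasure a l k i) := ⟨by
  have : 0 < l / 2 ^ k := by positivity
  rw [dyadicMeasure, Measure.smul_apply, Measure.restrict_apply_univ,
    arcLength_dyadicArc hl hl' hi, smul_eq_mul]
  exact ENNReal.inv_mul_cancel (by simpa using this) ENNReal.ofReal_ne_top⟩

lemma integrable_dyadicMeasure (hl : 0 < l) (hu : Integrable u arcLength) :
    Integrable u (dyadicMeasure a l k i) := by
  have : 0 < l / 2 ^ k := by positivity
  exact hu.restrict.smul_measure (ENNReal.inv_ne_top.2 (by simpa using this))

lemma lintegral_dyadicMeasure (F : ℂ → ℝ≥0∞) :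
    ∫⁻ x, F x ∂dyadicMeasure a l k i =
      (ENNReal.ofReal (l / 2 ^ k))⁻¹ * ∫⁻ x in dyadicArc a l k i, F x ∂arcLength := by
  rw [dyadicMeasure, lintegral_smul_measure, smul_eq_mul]

/-- The integrand of the Dirichlet integral of order `β`. -/
noncomputable def dirichletKernel (β : ℝ) (u : ℂ → ℂ) (x y : ℂ) : ℝ≥0∞ :=
  ‖u x - u y‖ₑ ^ 2 / ‖x - y‖ₑ ^ (1 + β)

lemma dirichletKernel_of_ne {x y : ℂ} (hxy : x ≠ y) : dirichletKernel β u x y =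
    ENNReal.ofReal (‖x - y‖ ^ (-(1 + β))) * ‖u x - u y‖ₑ ^ 2 := by
  have hd : 0 < ‖x - y‖ := norm_pos_iff.2 (sub_ne_zero.2 hxy)
  rw [dirichletKernel, ← ofReal_norm (x - y), ENNReal.ofReal_rpow_of_pos hd, div_eq_mul_inv,
    ← ENNReal.ofReal_inv_of_pos (by positivity), ← Real.rpow_neg hd.le, mul_comm]

lemma dirichletKernel_self (x : ℂ) : dirichletKernel β u x x = 0 := by
  simp [dirichletKernel]

lemma ofReal_mul_sq_le_dirichletKernel {x y : ℂ} {c B : ℝ}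
    (h : x ≠ y → c ≤ B * ‖x - y‖ ^ (-(1 + β))) :
    ENNReal.ofReal c * ‖u x - u y‖ₑ ^ 2 ≤ ENNReal.ofReal B * dirichletKernel β u x y := by
  rcases eq_or_ne x y with rfl | hxy
  · simp
  · rw [dirichletKernel_of_ne hxy, ← mul_assoc, ← ENNReal.ofReal_mul' (by positivity)]
    gcongr
    exact h hxy

lemma dirichletKernel_le_of_le {α : ℝ} (hβα : β ≤ α) {x y : ℂ} {B : ℝ} (hB : ‖x - y‖ ≤ B) :
    dirichletKernel β u x y ≤ ENNReal.ofReal (B ^ (α - β)) * dirichletKernel α u x y := by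
  rcases eq_or_ne x y with rfl | hxy
  · simp [dirichletKernel_self]
  · have hd : 0 < ‖x - y‖ := norm_pos_iff.2 (sub_ne_zero.2 hxy)
    rw [dirichletKernel_of_ne hxy]
    refine ofReal_mul_sq_le_dirichletKernel fun _ => ?_
    calc ‖x - y‖ ^ (-(1 + β)) = ‖x - y‖ ^ (α - β) * ‖x - y‖ ^ (-(1 + α)) := by
          rw [← Real.rpow_add hd]
          ring_nf
      _ ≤ _ := by
          have : 0 ≤ α - β := by linarith
          gcongr

lemma sq_sum_mul_le_weighted {ι : Type*} (s : Finset ι) (c f g : ι → ℝ≥0∞)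
    (hc : ∀ i, c i ≠ 0) (hc' : ∀ i, c i ≠ ⊤) :
    (∑ i ∈ s, f i * g i) ^ 2 ≤ (∑ i ∈ s, c i * f i ^ 2) * ∑ i ∈ s, (c i)⁻¹ * g i ^ 2 := by
  have h := sq_sum_mul_le s (fun i => c i ^ (1 / 2 : ℝ) * f i)
    (fun i => (c i)⁻¹ ^ (1 / 2 : ℝ) * g i)
  have h3 : ∀ i, c i ^ (1 / 2 : ℝ) * f i * ((c i)⁻¹ ^ (1 / 2 : ℝ) * g i) = f i * g i := by
    intro i
    rw [mul_mul_mul_comm, ← ENNReal.mul_rpow_of_nonneg _ _ (by norm_num),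
      ENNReal.mul_inv_cancel (hc i) (hc' i), ENNReal.one_rpow, one_mul]
  simp only [mul_pow, sq_rpow_half, h3] at h
  exact h

/-- Comparison of the mean values over a dyadic subarc and over its parent. -/
lemma weighted_sq_dyadicMean_sub_le (hβ1 : β ≤ 1) (hl : 0 < l)
    (hl' : l ≤ 2 * Real.pi) (hu : Integrable u arcLength) (hi : i < 2 ^ (k + 1)) :
    (ENNReal.ofReal ((l / 2 ^ (k + 1)) ^ (β - 1)))⁻¹ *
        ‖dyadicMean u a l (k + 1) i - dyadicMean u a l k (i / 2)‖ₑ ^ 2 ≤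
      ENNReal.ofReal (2 * (l / 2 ^ k) ^ (-(1 + β))) *
        ∫⁻ x in dyadicArc a l (k + 1) i, ∫⁻ y in dyadicArc a l k (i / 2), ‖u x - u y‖ₑ ^ 2
          ∂arcLength ∂arcLength := by
  have hi' : i / 2 < 2 ^ k := by rw [pow_succ] at hi; omega
  have := isProbabilityMeasure_dyadicMeasure (a := a) hl hl' hi
  have := isProbabilityMeasure_dyadicMeasure (a := a) hl hl' hi'
  have hρ : 0 < l / 2 ^ k := by positivity
  have hρ' : l / 2 ^ (k + 1) = (l / 2 ^ k) / 2 := by rw [pow_succ]; field_simp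
  have h := sq_enorm_integral_sub_integral_le (integrable_dyadicMeasure (a := a) (k := k + 1)
    (i := i) hl hu) (integrable_dyadicMeasure (a := a) (k := k) (i := i / 2) hl hu)
  simp_rw [lintegral_dyadicMeasure] at h
  rw [lintegral_const_mul' _ _ (ENNReal.inv_ne_top.2 (by simpa using hρ)), ← mul_assoc] at h
  rw [hρ'] at h ⊢
  set ρ := l / 2 ^ k
  refine (mul_le_mul_right h _).trans ?_
  rw [← mul_assoc]
  gcongr
  -- With ρ the length of the parent, the weight and the two normalizations combine to (ρ/2)^{1-β}
  -- (ρ/2)^{-1} ρ^{-1} = 2^β ρ^{-(1+β)}, and 2^β ≤ 2.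
  rw [← ENNReal.ofReal_inv_of_pos (by positivity), ← ENNReal.ofReal_inv_of_pos (by positivity),
    ← ENNReal.ofReal_inv_of_pos (by positivity), ← ENNReal.ofReal_mul (by positivity),
    ← ENNReal.ofReal_mul (by positivity)]
  refine ENNReal.ofReal_le_ofReal ?_
  have e1 : ((ρ / 2) ^ (β - 1))⁻¹ * (ρ / 2)⁻¹ = (ρ / 2) ^ (-β) := by
    rw [← Real.rpow_neg (by positivity), ← Real.rpow_neg_one (ρ / 2),
      ← Real.rpow_add (by positivity)]
    ring_nf
  have e2 : (ρ / 2) ^ (-β) = 2 ^ β * ρ ^ (-β) := by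
    rw [Real.div_rpow hρ.le two_pos.le, Real.rpow_neg two_pos.le]
    field_simp
  have e3 : ρ ^ (-β) * ρ⁻¹ = ρ ^ (-(1 + β)) := by
    rw [← Real.rpow_neg_one ρ, ← Real.rpow_add hρ]
    ring_nf
  have e4 : (2 : ℝ) ^ β ≤ 2 := by
    simpa using Real.rpow_le_rpow_of_exponent_le one_le_two hβ1
  calc _ = 2 ^ β * ρ ^ (-(1 + β)) := by rw [← mul_assoc, e1, e2, mul_assoc, e3]
    _ ≤ _ := by gcongr

/-- A pair x, y enters only at scales larger than |x - y|, so the powers of the scales sum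
geometrically to the Dirichlet kernel. The ratio costs a factor at most 2, which with the 2 from
each step makes 4. -/
lemma sum_weighted_sq_dyadicMean_sub_le (hβ : 0 < β) (hβ1 : β ≤ 1) (hl : 0 < l)
    (hl' : l ≤ 2 * Real.pi) (hu : Integrable u arcLength) (N : ℕ) :
    ∑ k ∈ Finset.range N, ∑ i ∈ Finset.range (2 ^ (k + 1)),
      (ENNReal.ofReal ((l / 2 ^ (k + 1)) ^ (β - 1)))⁻¹ *
        ‖dyadicMean u a l (k + 1) i - dyadicMean u a l k (i / 2)‖ₑ ^ 2 ≤
      ENNReal.ofReal 4 * ∫⁻ x in arc a l, ∫⁻ y in arc a l, dirichletKernel β u x y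
        ∂arcLength ∂arcLength := by
  have hstep : ∀ k, ∑ i ∈ Finset.range (2 ^ (k + 1)),
      (ENNReal.ofReal ((l / 2 ^ (k + 1)) ^ (β - 1)))⁻¹ *
        ‖dyadicMean u a l (k + 1) i - dyadicMean u a l k (i / 2)‖ₑ ^ 2 ≤
      ∫⁻ x in arc a l, ∫⁻ y in arc a l, ENNReal.ofReal (2 * (l / 2 ^ k) ^ (-(1 + β))) *
        (dyadicArc a l k (dyadicIndex a l k x)).indicator (fun y => ‖u x - u y‖ₑ ^ 2) y
          ∂arcLength ∂arcLength := by
    intro k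
    rw [setLIntegral_arc_eq_sum hl (k + 1)]
    refine Finset.sum_le_sum fun i hi => ?_
    refine (weighted_sq_dyadicMean_sub_le hβ1 hl hl' hu (Finset.mem_range.1 hi)).trans ?_
    rw [← lintegral_const_mul' _ _ ENNReal.ofReal_ne_top]
    refine setLIntegral_mono' measurableSet_dyadicArc fun x hx => ?_
    have hx' : dyadicIndex a l k x = i / 2 := by rw [← dyadicIndex_succ_div_two, hx.2]
    rw [lintegral_const_mul' _ _ ENNReal.ofReal_ne_top, hx',
      lintegral_indicator measurableSet_dyadicArc, Measure.restrict_restrict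
      measurableSet_dyadicArc, Set.inter_eq_left.2 dyadicArc_subset_arc]
  refine (Finset.sum_le_sum fun k _ => hstep k).trans ?_
  refine (sum_lintegral_le_lintegral_sum _ _ _).trans ?_
  rw [← lintegral_const_mul' _ _ ENNReal.ofReal_ne_top]
  refine setLIntegral_mono' measurableSet_arc fun x hx => ?_
  refine (sum_lintegral_le_lintegral_sum _ _ _).trans ?_
  rw [← lintegral_const_mul' _ _ ENNReal.ofReal_ne_top]
  refine lintegral_mono fun y => ?_
  calc _ ≤ ∑ k ∈ Finset.range N, ENNReal.ofReal (if ‖x - y‖ < l / 2 ^ k then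
          2 * (l / 2 ^ k) ^ (-(1 + β)) else 0) * ‖u x - u y‖ₑ ^ 2 := by
        refine Finset.sum_le_sum fun k _ => ?_
        by_cases hy : y ∈ dyadicArc a l k (dyadicIndex a l k x)
        · rw [Set.indicator_of_mem hy, if_pos (norm_sub_lt_of_mem_dyadicArc hl ⟨hx, rfl⟩ hy)]
        · simp [hy]
    _ = ENNReal.ofReal (∑ k ∈ Finset.range N, if ‖x - y‖ < l / 2 ^ k then
          2 * (l / 2 ^ k) ^ (-(1 + β)) else 0) * ‖u x - u y‖ₑ ^ 2 := by
        rw [ENNReal.ofReal_sum_of_nonneg fun k _ => by split_ifs <;> positivity, Finset.sum_mul]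
    _ ≤ _ := by
        refine ofReal_mul_sq_le_dirichletKernel fun hxy => ?_
        have hd : 0 < ‖x - y‖ := norm_pos_iff.2 (sub_ne_zero.2 hxy)
        have h := sum_scale_rpow_neg_le hl (p := 1 + β) (by linarith) hd N
        have h2 : (1 - (2 : ℝ) ^ (-(1 + β)))⁻¹ ≤ 2 := by
          have h3 : (2 : ℝ) ^ (-(1 + β)) ≤ 2 ^ (-1 : ℝ) :=
            Real.rpow_le_rpow_of_exponent_le one_le_two (by linarith)
          rw [Real.rpow_neg_one] at h3
          rw [inv_le_comm₀ (by linarith) two_pos]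
          linarith
        calc _ = 2 * ∑ k ∈ Finset.range N,
              (if ‖x - y‖ < l / 2 ^ k then (l / 2 ^ k) ^ (-(1 + β)) else 0) := by
              rw [Finset.mul_sum]
              exact Finset.sum_congr rfl fun k _ => by split_ifs <;> simp
          _ ≤ 2 * ((1 - 2 ^ (-(1 + β)))⁻¹ * ‖x - y‖ ^ (-(1 + β))) := by gcongr
          _ ≤ 2 * (2 * ‖x - y‖ ^ (-(1 + β))) := by gcongr
          _ = _ := by ring

/-- The mean oscillation of the dyadic means with respect to a measure of finite energy. -/
lemma sq_lintegral_dyadicMean_sub_le (hβ : 0 < β) (hβ1 : β ≤ 1) (hl : 0 < l)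
    (hl' : l ≤ 2 * Real.pi) (hu : Integrable u arcLength) {μ : Measure ℂ}
    (hμ : μ (arc a l)ᶜ = 0) (N : ℕ) :
    (∫⁻ z, ‖dyadicMean u a l 0 0 - dyadicMean u a l N (dyadicIndex a l N z)‖ₑ ∂μ) ^ 2 ≤
      (∑' k, dyadicEnergy β a l μ k) * (ENNReal.ofReal 4 *
        ∫⁻ x in arc a l, ∫⁻ y in arc a l, dirichletKernel β u x y ∂arcLength ∂arcLength) := by
  have hae : ∀ᵐ z ∂μ, z ∈ arc a l := by rwa [ae_iff]
  have hr : μ.restrict (arc a l) = μ := Measure.restrict_eq_self_of_ae_mem hae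
  set d : ℕ → ℕ → ℝ≥0∞ := fun k i =>
    ‖dyadicMean u a l (k + 1) i - dyadicMean u a l k (i / 2)‖ₑ
  have h1 : ∫⁻ z, ‖dyadicMean u a l 0 0 - dyadicMean u a l N (dyadicIndex a l N z)‖ₑ ∂μ ≤
      ∑ k ∈ Finset.range N, ∑ i ∈ Finset.range (2 ^ (k + 1)),
        μ (dyadicArc a l (k + 1) i) * d k i := by
    -- Telescoping along the nested subarcs that contain z.
    calc _ ≤ ∫⁻ z, ∑ k ∈ Finset.range N, d k (dyadicIndex a l (k + 1) z) ∂μ := by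
          refine lintegral_mono_ae ?_
          filter_upwards [hae] with z hz
          have h0 : dyadicIndex a l 0 z = 0 := by
            have := dyadicIndex_lt (k := 0) hl hz
            omega
          clear hr
          induction N with
          | zero => simp [h0]
          | succ N ih =>
            rw [Finset.sum_range_succ]
            refine le_trans ?_ (add_le_add_left ih _)
            have h2 : d N (dyadicIndex a l (N + 1) z) =
                ‖dyadicMean u a l N (dyadicIndex a l N z) -
                  dyadicMean u a l (N + 1) (dyadicIndex a l (N + 1) z)‖ₑ := by
              simp only [d]
              rw [dyadicIndex_succ_div_two, enorm_sub_rev]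
            rw [h2]
            simp_rw [← edist_eq_enorm_sub]
            exact edist_triangle _ _ _
      _ = ∑ k ∈ Finset.range N, ∫⁻ z, d k (dyadicIndex a l (k + 1) z) ∂μ :=
          lintegral_finsetSum _ fun k _ =>
            (measurable_from_nat (f := d k)).comp measurable_dyadicIndex
      _ = _ := by
          refine Finset.sum_congr rfl fun k _ => ?_
          have := setLIntegral_dyadicIndex (a := a) hl (k + 1) μ (d k)
          rw [hr] at this
          rw [this]
          exact Finset.sum_congr rfl fun i _ => mul_comm _ _
  calc _ ≤ (∑ k ∈ Finset.range N, ∑ i ∈ Finset.range (2 ^ (k + 1)),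
        μ (dyadicArc a l (k + 1) i) * d k i) ^ 2 := by gcongr
    _ ≤ (∑ k ∈ Finset.range N, dyadicEnergy β a l μ (k + 1)) *
        ∑ k ∈ Finset.range N, ∑ i ∈ Finset.range (2 ^ (k + 1)),
          (ENNReal.ofReal ((l / 2 ^ (k + 1)) ^ (β - 1)))⁻¹ * d k i ^ 2 := by
        -- The weights (l/2^(k+1))^{β-1} turn one factor into the dyadic energy of μ and the other
        -- into the sum controlled by the local Dirichlet integral.
        have h := sq_sum_mul_le_weighted
          ((Finset.range N).sigma fun k => Finset.range (2 ^ (k + 1)))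
          (fun p => ENNReal.ofReal ((l / 2 ^ (p.1 + 1)) ^ (β - 1)))
          (fun p => μ (dyadicArc a l (p.1 + 1) p.2)) (fun p => d p.1 p.2)
          (fun p => by
            have : 0 < (l / 2 ^ (p.1 + 1)) ^ (β - 1) := by positivity
            simpa using this) (fun p => ENNReal.ofReal_ne_top)
        simp only [Finset.sum_sigma] at h
        simpa only [dyadicEnergy, Finset.mul_sum] using h
    _ ≤ _ := by
        gcongr
        · exact (ENNReal.sum_le_tsum _).trans
            (ENNReal.tsum_comp_le_tsum_of_injective (add_left_injective 1) _)
        · exact sum_weighted_sq_dyadicMean_sub_le hβ hβ1 hl hl' hu N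

end

/-! ### From dyadic means to radial limits: the Poincaré inequality. -/

section

variable {a l β : ℝ} {k i : ℕ} {u : ℂ → ℂ}

/-- Put m = max(ρ, |w - y|). The triangle inequality gives m ≤ 9 max(ρ/8, |w - z|), hence the kernel
is at most 81 ρ/m²; then ρ^{1-β} ≤ m^{1-β} is traded for the power of |w - y|. Dividing ρ by 8 keeps
the radius in [0, 1), as an arc may be as long as 2π. -/
lemma poissonKernel_le_rpow (hβ : 0 < β) (hβ1 : β ≤ 1) {z w y : ℂ} (hz : ‖z‖ = 1) (hw : ‖w‖ = 1)
    {ρ : ℝ} (hρ : 0 < ρ) (hρ8 : ρ < 8) (hy : ‖z - y‖ ≤ ρ) (hwy : w ≠ y) :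
    poissonKernel 0 ((1 - ρ / 8 : ℝ) * z) w ≤ 81 * ρ ^ β * ‖w - y‖ ^ (-(1 + β)) := by
  have h := poissonKernel_le_of_norm_eq_one hz hw (r := 1 - ρ / 8)
    ⟨by linarith, by linarith⟩
  have hd : 0 < ‖w - y‖ := norm_pos_iff.2 (sub_ne_zero.2 hwy)
  rw [sub_sub_cancel] at h
  set M := max (ρ / 8) ‖w - z‖
  set m := max ρ ‖w - y‖
  have hM1 : ρ / 8 ≤ M := le_max_left _ _
  have hM : 0 < M := by linarith
  have hm : 0 < m := lt_max_of_lt_left hρ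
  have hmM : m ≤ 9 * M := by
    refine max_le (by linarith) ?_
    have h1 : ‖w - z‖ ≤ M := le_max_right _ _
    have h2 := norm_sub_le_norm_sub_add_norm_sub w z y
    linarith
  calc _ ≤ 8 * (ρ / 8) / M ^ 2 := h
    _ ≤ 81 * (ρ / m ^ 2) := by
        rw [mul_div_cancel₀ _ (by norm_num), ← mul_div_assoc, div_le_div_iff₀ (by positivity)
          (by positivity)]
        calc ρ * m ^ 2 ≤ ρ * (9 * M) ^ 2 := by gcongr
          _ = _ := by ring
    _ ≤ 81 * (ρ ^ β * ‖w - y‖ ^ (-(1 + β))) := by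
        gcongr
        rw [Real.rpow_neg hd.le, ← div_eq_mul_inv, div_le_div_iff₀ (by positivity)
          (by positivity)]
        calc ρ * ‖w - y‖ ^ (1 + β) = ρ ^ β * (ρ ^ (1 - β) * ‖w - y‖ ^ (1 + β)) := by
              rw [← mul_assoc, ← Real.rpow_add hρ]
              norm_num
          _ ≤ ρ ^ β * (m ^ (1 - β) * m ^ (1 + β)) := by
              have h1 : 0 ≤ 1 - β := by linarith
              gcongr
              · exact le_max_left _ _
              · exact le_max_right _ _
          _ = ρ ^ β * m ^ 2 := by
              rw [← Real.rpow_add hm, ← Real.rpow_natCast]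
              norm_num
    _ = _ := by ring

lemma sq_enorm_integral_poissonKernel_sub_le {z : ℂ} (hz : ‖z‖ < 1) {g : ℂ → ℂ}
    (hg : MemLp g 2 normArcLength) (c : ℂ) :
    ‖(∫ w, (poissonKernel 0 z w : ℂ) * g w ∂normArcLength) - c‖ₑ ^ 2 ≤
      ∫⁻ w, ENNReal.ofReal (poissonKernel 0 z w) * ‖g w - c‖ₑ ^ 2 ∂normArcLength := by
  have hm : Measurable fun w => ENNReal.ofReal (poissonKernel 0 z w) :=
    (measurable_poissonKernel z).ennreal_ofReal
  have : IsProbabilityMeasure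
      (normArcLength.withDensity fun w => ENNReal.ofReal (poissonKernel 0 z w)) := ⟨by
    rw [withDensity_apply _ MeasurableSet.univ, Measure.restrict_univ, lintegral_poissonKernel hz]⟩
  have hgm : AEMeasurable (fun w => ‖g w - c‖ₑ) normArcLength :=
    (hg.1.sub aestronglyMeasurable_const).enorm
  have hac := withDensity_absolutelyContinuous normArcLength
    fun w => ENNReal.ofReal (poissonKernel 0 z w)
  have h := sq_lintegral_le (hgm.mono_ac hac)
  rw [lintegral_withDensity_eq_lintegral_mul₀ hm.aemeasurable hgm,
    lintegral_withDensity_eq_lintegral_mul₀ hm.aemeasurable (hgm.pow_const 2)] at h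
  refine le_trans ?_ h
  gcongr
  exact enorm_integral_poissonKernel_sub_le hz (integrable_poissonKernel_mul hz hg) c

lemma integrable_arcLength_of_memLp (hu : MemLp u 2 normArcLength) : Integrable u arcLength := by
  rw [arcLength_eq_smul]
  exact (hu.integrable (by norm_num)).smul_measure ENNReal.ofReal_ne_top

lemma scale_lt_eight (hl : 0 < l) (hl' : l ≤ 2 * Real.pi) (k : ℕ) : l / 2 ^ k < 8 := by
  have h1 : l / 2 ^ k ≤ l := div_le_self hl.le (one_le_pow₀ one_le_two)
  linarith [Real.pi_lt_d2]

/-- Comparison of a Poisson integral with a dyadic mean. -/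
lemma weighted_sq_poisson_sub_dyadicMean_le (hβ : 0 < β) (hβ1 : β ≤ 1) (hl : 0 < l)
    (hl' : l ≤ 2 * Real.pi) (hu : MemLp u 2 normArcLength) {z : ℂ}
    (hz : z ∈ dyadicArc a l k i) :
    ‖(∫ w, (poissonKernel 0 ((1 - l / 2 ^ k / 8 : ℝ) * z) w : ℂ) * u w ∂normArcLength) -
        dyadicMean u a l k i‖ₑ ^ 2 ≤
      ENNReal.ofReal ((l / 2 ^ k) ^ (β - 1)) * (ENNReal.ofReal 81 *
        ∫⁻ w, ∫⁻ y in dyadicArc a l k i, dirichletKernel β u w y ∂arcLength ∂normArcLength) := by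
  have hi : i < 2 ^ k := hz.2 ▸ dyadicIndex_lt hl hz.1
  have := isProbabilityMeasure_dyadicMeasure (a := a) hl hl' hi
  have hρ : 0 < l / 2 ^ k := by positivity
  have hρ8 := scale_lt_eight hl hl' k
  have hdist : ∀ y ∈ dyadicArc a l k i, ‖z - y‖ ≤ l / 2 ^ k := fun y hy =>
    (norm_sub_lt_of_mem_dyadicArc hl hz hy).le
  set ρ := l / 2 ^ k
  have hrz : ‖((1 - ρ / 8 : ℝ) : ℂ) * z‖ < 1 :=
    norm_ofReal_mul_lt_one hz.1.1 ⟨by linarith, by linarith⟩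
  refine (sq_enorm_integral_poissonKernel_sub_le hrz hu _).trans ?_
  rw [← lintegral_const_mul' _ _ ENNReal.ofReal_ne_top,
    ← lintegral_const_mul' _ _ ENNReal.ofReal_ne_top]
  refine lintegral_mono_ae ?_
  filter_upwards [ae_normArcLength_norm_eq_one] with w hw
  calc _ ≤ ENNReal.ofReal (poissonKernel 0 ((1 - ρ / 8 : ℝ) * z) w) *
        ((ENNReal.ofReal ρ)⁻¹ * ∫⁻ y in dyadicArc a l k i, ‖u w - u y‖ₑ ^ 2 ∂arcLength) := by
        gcongr
        rw [← lintegral_dyadicMeasure]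
        exact sq_enorm_sub_integral_le
          (integrable_dyadicMeasure hl (integrable_arcLength_of_memLp hu)) (u w)
    _ = (ENNReal.ofReal ρ)⁻¹ * ∫⁻ y in dyadicArc a l k i,
          ENNReal.ofReal (poissonKernel 0 ((1 - ρ / 8 : ℝ) * z) w) * ‖u w - u y‖ₑ ^ 2
          ∂arcLength := by
        rw [lintegral_const_mul' _ _ ENNReal.ofReal_ne_top]
        ring
    _ ≤ (ENNReal.ofReal ρ)⁻¹ * ∫⁻ y in dyadicArc a l k i,
          ENNReal.ofReal (81 * ρ ^ β) * dirichletKernel β u w y ∂arcLength := by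
        refine mul_le_mul_right ?_ _
        refine setLIntegral_mono' measurableSet_dyadicArc fun y hy => ?_
        exact ofReal_mul_sq_le_dirichletKernel fun hwy =>
          poissonKernel_le_rpow hβ hβ1 hz.1.1 hw hρ hρ8 (hdist y hy) hwy
    _ = _ := by
        rw [lintegral_const_mul' _ _ ENNReal.ofReal_ne_top, ← mul_assoc, ← mul_assoc,
          ← ENNReal.ofReal_inv_of_pos hρ, ← ENNReal.ofReal_mul (by positivity),
          ← ENNReal.ofReal_mul (by positivity)]
        congr 2
        rw [Real.rpow_sub_one hρ.ne']
        ring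

/-- The total oscillation of `u` of order `β`. -/
noncomputable def totalDirichlet (β : ℝ) (u : ℂ → ℂ) : ℝ≥0∞ :=
  ∫⁻ w, ∫⁻ y, dirichletKernel β u w y ∂arcLength ∂normArcLength

/-- The Poisson kernel sees the whole circle, so the total Dirichlet integral enters; but it
multiplies the single N-th term of the dyadic energy, which tends to 0 when the series converges.
This keeps the final estimate local. -/
lemma sq_lintegral_poisson_sub_dyadicMean_le (hβ : 0 < β) (hβ1 : β ≤ 1) (hl : 0 < l)
    (hl' : l ≤ 2 * Real.pi) (hu : MemLp u 2 normArcLength) {μ : Measure ℂ}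
    (hμ : μ (arc a l)ᶜ = 0) (N : ℕ) :
    (∫⁻ z, ‖(∫ w, (poissonKernel 0 ((1 - l / 2 ^ N / 8 : ℝ) * z) w : ℂ) * u w ∂normArcLength) -
        dyadicMean u a l N (dyadicIndex a l N z)‖ₑ ∂μ) ^ 2 ≤
      dyadicEnergy β a l μ N * (ENNReal.ofReal 81 * totalDirichlet β u) := by
  have hae : ∀ᵐ z ∂μ, z ∈ arc a l := by rwa [ae_iff]
  have hr : μ.restrict (arc a l) = μ := Measure.restrict_eq_self_of_ae_mem hae
  have hρ : 0 < l / 2 ^ N := by positivity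
  set c := ENNReal.ofReal ((l / 2 ^ N) ^ (β - 1)) with hc
  have hc0 : c ≠ 0 := by
    have : 0 < (l / 2 ^ N) ^ (β - 1) := by positivity
    simpa [c] using this
  set D : ℕ → ℝ≥0∞ := fun i =>
    ∫⁻ w, ∫⁻ y in dyadicArc a l N i, dirichletKernel β u w y ∂arcLength ∂normArcLength
  set b : ℕ → ℝ≥0∞ := fun i => (c * (ENNReal.ofReal 81 * D i)) ^ (1 / 2 : ℝ)
  have hb : ∀ i, b i ^ 2 = c * (ENNReal.ofReal 81 * D i) := fun i => sq_rpow_half _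
  have h1 : ∫⁻ z, ‖(∫ w, (poissonKernel 0 ((1 - l / 2 ^ N / 8 : ℝ) * z) w : ℂ) * u w
      ∂normArcLength) - dyadicMean u a l N (dyadicIndex a l N z)‖ₑ ∂μ ≤
      ∑ i ∈ Finset.range (2 ^ N), μ (dyadicArc a l N i) * b i := by
    calc _ ≤ ∫⁻ z, b (dyadicIndex a l N z) ∂μ := by
          refine lintegral_mono_ae ?_
          filter_upwards [hae] with z hz
          have h := weighted_sq_poisson_sub_dyadicMean_le hβ hβ1 hl hl' hu
            (show z ∈ dyadicArc a l N (dyadicIndex a l N z) from ⟨hz, rfl⟩)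
          exact le_rpow_half_of_sq_le h
      _ = _ := by
          have := setLIntegral_dyadicIndex (a := a) hl N μ b
          rw [hr] at this
          rw [this]
          exact Finset.sum_congr rfl fun i _ => mul_comm _ _
  calc _ ≤ (∑ i ∈ Finset.range (2 ^ N), μ (dyadicArc a l N i) * b i) ^ 2 := by gcongr
    _ ≤ (∑ i ∈ Finset.range (2 ^ N), c * μ (dyadicArc a l N i) ^ 2) *
        ∑ i ∈ Finset.range (2 ^ N), c⁻¹ * b i ^ 2 :=
        sq_sum_mul_le_weighted _ (fun _ => c) _ _ (fun _ => hc0) (fun _ => ENNReal.ofReal_ne_top)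
    _ = dyadicEnergy β a l μ N * (ENNReal.ofReal 81 * ∑ i ∈ Finset.range (2 ^ N), D i) := by
        rw [dyadicEnergy, ← Finset.mul_sum, Finset.mul_sum _ _ (ENNReal.ofReal 81)]
        congr 1
        refine Finset.sum_congr rfl fun i _ => ?_
        rw [hb, ← mul_assoc, ENNReal.inv_mul_cancel hc0 ENNReal.ofReal_ne_top, one_mul]
    _ ≤ _ := by
        gcongr
        refine (sum_lintegral_le_lintegral_sum _ _ _).trans ?_
        refine lintegral_mono fun w => ?_
        simp only
        rw [← setLIntegral_arc_eq_sum hl N]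
        exact setLIntegral_le_lintegral _ _

/-- If the Poisson integral of `u` has radial limit zero almost everywhere with respect to a
measure of finite energy on an arc, then the mean of `u` over the arc is controlled by the local
Dirichlet integral of `u`. -/
lemma sq_enorm_dyadicMean_le (hβ : 0 < β) (hβ1 : β ≤ 1) (hl : 0 < l)
    (hl' : l ≤ 2 * Real.pi) (hu : MemLp u 2 normArcLength) (hD : totalDirichlet β u ≠ ⊤)
    {f : ℂ → ℂ} (hf : DifferentiableOn ℂ f (Metric.ball 0 1))
    (hfu : ∀ z : ℂ, ‖z‖ < 1 → f z = ∫ w, (poissonKernel 0 z w : ℂ) * u w ∂normArcLength)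
    {μ : Measure ℂ} [IsProbabilityMeasure μ] (hμ : μ (arc a l)ᶜ = 0)
    (hlim : ∀ᵐ z ∂μ, HasRadialLimit f z 0) (hS : ∑' k, dyadicEnergy β a l μ k ≠ ⊤) :
    ‖dyadicMean u a l 0 0‖ₑ ^ 2 ≤ (∑' k, dyadicEnergy β a l μ k) * (ENNReal.ofReal 4 *
        ∫⁻ x in arc a l, ∫⁻ y in arc a l, dirichletKernel β u x y ∂arcLength ∂arcLength) := by
  have hae : ∀ᵐ z ∂μ, z ∈ arc a l := by rwa [ae_iff]
  set X := (∑' k, dyadicEnergy β a l μ k) * (ENNReal.ofReal 4 *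
        ∫⁻ x in arc a l, ∫⁻ y in arc a l, dirichletKernel β u x y ∂arcLength ∂arcLength)
  set r : ℕ → ℝ := fun N => 1 - l / 2 ^ N / 8
  have hr : ∀ N, r N ∈ Set.Ico (0 : ℝ) 1 := by
    intro N
    have h1 := scale_lt_eight hl hl' N
    have h2 : 0 < l / 2 ^ N := by positivity
    constructor <;> simp only [r] <;> linarith
  have hrlim : Tendsto r atTop (𝓝[<] 1) := by
    refine tendsto_nhdsWithin_iff.2 ⟨?_, Eventually.of_forall fun n => (hr n).2⟩
    have h1 : Tendsto (fun n : ℕ => (1 / 2 : ℝ) ^ n) atTop (𝓝 0) :=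
      tendsto_pow_atTop_nhds_zero_of_lt_one (by norm_num) (by norm_num)
    have h2 := (h1.const_mul (l / 8)).const_sub 1
    rw [mul_zero, sub_zero] at h2
    refine h2.congr fun n => ?_
    simp only [r]
    rw [one_div, inv_pow]
    ring
  set ε : ℕ → ℝ≥0∞ := fun N =>
    (dyadicEnergy β a l μ N * (ENNReal.ofReal 81 * totalDirichlet β u)) ^ (1 / 2 : ℝ)
  have hε : Tendsto ε atTop (𝓝 0) := by
    have h1 := ENNReal.tendsto_atTop_zero_of_tsum_ne_top hS
    have h2 := ENNReal.Tendsto.mul_const (b := ENNReal.ofReal 81 * totalDirichlet β u) h1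
      (Or.inr (ENNReal.mul_ne_top ENNReal.ofReal_ne_top hD))
    rw [zero_mul] at h2
    have h3 := ((ENNReal.continuous_rpow_const (y := 1 / 2)).tendsto 0).comp h2
    rwa [ENNReal.zero_rpow_of_pos (by norm_num)] at h3
  have hstep : ∀ N, ∫⁻ z, ‖dyadicMean u a l 0 0 - f (r N * z)‖ₑ ∂μ ≤
      X ^ (1 / 2 : ℝ) + ε N := by
    intro N
    calc _ ≤ ∫⁻ z, (‖dyadicMean u a l 0 0 - dyadicMean u a l N (dyadicIndex a l N z)‖ₑ +
          ‖f (r N * z) - dyadicMean u a l N (dyadicIndex a l N z)‖ₑ) ∂μ := by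
          refine lintegral_mono fun z => ?_
          simp_rw [← edist_eq_enorm_sub]
          exact edist_triangle_right _ _ _
      _ = ∫⁻ z, ‖dyadicMean u a l 0 0 - dyadicMean u a l N (dyadicIndex a l N z)‖ₑ ∂μ +
          ∫⁻ z, ‖f (r N * z) - dyadicMean u a l N (dyadicIndex a l N z)‖ₑ ∂μ :=
          lintegral_add_left ((measurable_from_nat
            (f := fun i => ‖dyadicMean u a l 0 0 - dyadicMean u a l N i‖ₑ)).comp
            measurable_dyadicIndex) _
      _ ≤ _ := by
          refine add_le_add (le_rpow_half_of_sq_le ?_) (le_rpow_half_of_sq_le ?_)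
          · exact sq_lintegral_dyadicMean_sub_le hβ hβ1 hl hl'
              (integrable_arcLength_of_memLp hu) hμ N
          · refine le_trans (le_of_eq ?_)
              (sq_lintegral_poisson_sub_dyadicMean_le hβ hβ1 hl hl' hu hμ N)
            congr 1
            refine lintegral_congr_ae ?_
            filter_upwards [hae] with z hz
            rw [hfu _ (norm_ofReal_mul_lt_one hz.1 (hr N))]
  have hfinal : ‖dyadicMean u a l 0 0‖ₑ ≤ X ^ (1 / 2 : ℝ) := by
    -- Fatou's lemma for μ: f(r_N z) → 0 almost everywhere, and the error ε_N disappears in the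
    -- limit.
    calc ‖dyadicMean u a l 0 0‖ₑ
        = ∫⁻ z, liminf (fun N => ‖dyadicMean u a l 0 0 - f (r N * z)‖ₑ) atTop ∂μ := by
          have : ∀ᵐ z ∂μ, liminf (fun N => ‖dyadicMean u a l 0 0 - f (r N * z)‖ₑ) atTop =
              ‖dyadicMean u a l 0 0‖ₑ := by
            filter_upwards [hlim] with z hz
            have h1 : Tendsto (fun N => f (r N * z)) atTop (𝓝 0) := hz.comp hrlim
            have h2 := (h1.const_sub (dyadicMean u a l 0 0)).enorm
            rw [sub_zero] at h2
            exact h2.liminf_eq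
          rw [lintegral_congr_ae this]
          simp
      _ ≤ liminf (fun N => ∫⁻ z, ‖dyadicMean u a l 0 0 - f (r N * z)‖ₑ ∂μ) atTop := by
          refine lintegral_liminf_le' fun N => ?_
          have hm : μ.restrict (Metric.closedBall 0 1) = μ := by
            refine Measure.restrict_eq_self_of_ae_mem ?_
            filter_upwards [hae] with z hz
            simp [hz.1]
          rw [← hm]
          exact ((continuousOn_const.sub (continuousOn_comp_mul hf (hr N))).enorm).aemeasurable
            Metric.isClosed_closedBall.measurableSet
      _ ≤ liminf (fun N => X ^ (1 / 2 : ℝ) + ε N) atTop :=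
          liminf_le_liminf (Eventually.of_forall hstep)
      _ = X ^ (1 / 2 : ℝ) := by
          have := hε.const_add (X ^ (1 / 2 : ℝ))
          rw [add_zero] at this
          exact this.liminf_eq
  calc ‖dyadicMean u a l 0 0‖ₑ ^ 2 ≤ (X ^ (1 / 2 : ℝ)) ^ 2 := by gcongr
    _ = X := sq_rpow_half _

/-- This is the term k = 0. It bounds the energy below by a multiple of l^{β-1}, so the variance of
u over the arc can be absorbed into the energy term, and capacities of subsets of the arc are
finite. -/
lemma ofReal_rpow_le_tsum_dyadicEnergy (hl : 0 < l) {μ : Measure ℂ} [IsProbabilityMeasure μ]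
    (hμ : μ (arc a l)ᶜ = 0) : ENNReal.ofReal (l ^ (β - 1)) ≤ ∑' k, dyadicEnergy β a l μ k := by
  refine le_trans ?_ (ENNReal.le_tsum 0)
  have h1 : μ (arc a l) = 1 := (prob_compl_eq_zero_iff measurableSet_arc).1 hμ
  simp [dyadicEnergy, dyadicArc_zero hl, h1]

/-- A **Poincaré inequality** on arcs, in terms of the energy of a measure carried by the set of
radial zeros. -/
lemma exists_poincare (hβ : 0 < β) (hβ1 : β ≤ 1) : ∃ C : ℝ, 0 < C ∧ ∀ (a l : ℝ), 0 < l →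
    l ≤ 2 * Real.pi → ∀ f u : ℂ → ℂ, MemLp u 2 normArcLength → totalDirichlet β u ≠ ⊤ →
    DifferentiableOn ℂ f (Metric.ball 0 1) →
    (∀ z : ℂ, ‖z‖ < 1 → f z = ∫ w, (poissonKernel 0 z w : ℂ) * u w ∂normArcLength) →
    ∀ μ : Measure ℂ, IsProbabilityMeasure μ → μ (arc a l)ᶜ = 0 →
    (∀ᵐ z ∂μ, HasRadialLimit f z 0) → energy (1 - β) μ ≠ ⊤ →
    ∫⁻ x in arc a l, ‖u x‖ₑ ^ 2 ∂arcLength ≤ ENNReal.ofReal l * (ENNReal.ofReal C *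
      energy (1 - β) μ * ∫⁻ x in arc a l, ∫⁻ y in arc a l, dirichletKernel β u x y
        ∂arcLength ∂arcLength) := by
  obtain ⟨C, hC, hE⟩ := exists_tsum_dyadicEnergy_le hβ1
  -- From |u|² ≤ 2|u - A|² + 2|A|²: the variance contributes 2 and the mean 2 · 4.
  refine ⟨10 * C, by positivity, fun a l hl hl' f u hu hD hf hfu μ _ hμ hlim hfin => ?_⟩
  have hS := hE a l hl hl' μ inferInstance hμ
  have hSfin : ∑' k, dyadicEnergy β a l μ k ≠ ⊤ :=
    (hS.trans_lt (ENNReal.mul_lt_top ENNReal.ofReal_lt_top hfin.lt_top)).ne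
  have hmean := sq_enorm_dyadicMean_le hβ hβ1 hl hl' hu hD hf hfu hμ hlim hSfin
  set DI := ∫⁻ x in arc a l, ∫⁻ y in arc a l, dirichletKernel β u x y ∂arcLength ∂arcLength
  set A := dyadicMean u a l 0 0
  have hprob := isProbabilityMeasure_dyadicMeasure (a := a) (k := 0) (i := 0) hl hl' (by simp)
  have hlow := (ofReal_rpow_le_tsum_dyadicEnergy (β := β) hl hμ).trans hS
  have hvar : ∫⁻ x in arc a l, ‖u x - A‖ₑ ^ 2 ∂arcLength ≤
      ENNReal.ofReal l * (ENNReal.ofReal (l ^ (β - 1)) * DI) := by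
    -- On the arc |x - y| < l, so 1 ≤ l^{1+β} |x - y|^{-(1+β)} off the diagonal.
    have h1 : ∀ x ∈ arc a l, ‖u x - A‖ₑ ^ 2 ≤ ENNReal.ofReal (l⁻¹ * l ^ (1 + β)) *
        ∫⁻ y in arc a l, dirichletKernel β u x y ∂arcLength := by
      intro x hx
      refine (sq_enorm_sub_integral_le
        (integrable_dyadicMeasure hl (integrable_arcLength_of_memLp hu)) (u x)).trans ?_
      rw [lintegral_dyadicMeasure, dyadicArc_zero hl, pow_zero, div_one,
        ← ENNReal.ofReal_inv_of_pos hl, ← lintegral_const_mul' _ _ ENNReal.ofReal_ne_top,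
        ← lintegral_const_mul' _ _ ENNReal.ofReal_ne_top]
      refine setLIntegral_mono' measurableSet_arc fun y hy => ?_
      refine ofReal_mul_sq_le_dirichletKernel fun hxy => ?_
      have hd : 0 < ‖x - y‖ := norm_pos_iff.2 (sub_ne_zero.2 hxy)
      rw [← dyadicArc_zero hl] at hx hy
      have hle := (norm_sub_lt_of_mem_dyadicArc hl hx hy).le
      rw [pow_zero, div_one] at hle
      rw [mul_assoc]
      refine le_mul_of_one_le_right (by positivity) ?_
      rw [Real.rpow_neg hd.le, ← div_eq_mul_inv, one_le_div (by positivity)]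
      gcongr
    calc _ ≤ ∫⁻ x in arc a l, ENNReal.ofReal (l⁻¹ * l ^ (1 + β)) *
          ∫⁻ y in arc a l, dirichletKernel β u x y ∂arcLength ∂arcLength :=
          setLIntegral_mono' measurableSet_arc h1
      _ = _ := by
          rw [lintegral_const_mul' _ _ ENNReal.ofReal_ne_top, ← mul_assoc,
            ← ENNReal.ofReal_mul hl.le]
          congr 2
          rw [Real.rpow_sub_one hl.ne', Real.rpow_add hl, Real.rpow_one]
          field_simp
  calc ∫⁻ x in arc a l, ‖u x‖ₑ ^ 2 ∂arcLength
      ≤ ∫⁻ x in arc a l, (2 * ‖u x - A‖ₑ ^ 2 + 2 * ‖A‖ₑ ^ 2) ∂arcLength :=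
        lintegral_mono fun x => enorm_sq_le_two_mul _ _
    _ = 2 * ∫⁻ x in arc a l, ‖u x - A‖ₑ ^ 2 ∂arcLength + ENNReal.ofReal l * (2 * ‖A‖ₑ ^ 2) := by
        rw [lintegral_add_right _ measurable_const, lintegral_const_mul' _ _ (by norm_num),
          setLIntegral_const, arcLength_arc hl hl', mul_comm (2 * ‖A‖ₑ ^ 2)]
    _ ≤ 2 * (ENNReal.ofReal l * (ENNReal.ofReal C * energy (1 - β) μ * DI)) +
        ENNReal.ofReal l * (2 * (ENNReal.ofReal C * energy (1 - β) μ * (4 * DI))) := by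
        gcongr
        · refine hvar.trans ?_
          gcongr
        · refine hmean.trans ?_
          rw [show ENNReal.ofReal 4 = 4 by norm_num]
          gcongr
    _ = ENNReal.ofReal l * (10 * ENNReal.ofReal C * energy (1 - β) μ * DI) := by ring
    _ = _ := by
        rw [ENNReal.ofReal_mul (by norm_num), show ENNReal.ofReal 10 = 10 by norm_num]

end

/-! ### Capacity, Jensen's inequality and extended-real sums. -/

section

variable {a l α β : ℝ} {u : ℂ → ℂ}

lemma probMeasuresOn_compl_eq_zero {S T : Set ℂ} (hST : S ⊆ T) {μ : Measure ℂ}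
    (hμ : μ ∈ probMeasuresOn S) : μ Tᶜ = 0 := by
  obtain ⟨-, K, -, hK, h0⟩ := hμ
  exact measure_mono_null (Set.compl_subset_compl.2 (hK.trans hST)) h0

lemma capacity_inter_arc_lt_top (hβ1 : β ≤ 1) (hl : 0 < l) (hl' : l ≤ 2 * Real.pi) (E : Set ℂ) :
    capacity (1 - β) (E ∩ arc a l) < ⊤ := by
  obtain ⟨C, hC, hE⟩ := exists_tsum_dyadicEnergy_le hβ1
  have hpos : 0 < ENNReal.ofReal (l ^ (β - 1)) / ENNReal.ofReal C :=
    ENNReal.div_pos (by have : 0 < l ^ (β - 1) := by positivity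
                        simpa using this) ENNReal.ofReal_ne_top
  rw [capacity, ENNReal.inv_lt_top]
  refine hpos.trans_le (le_iInf₂ fun μ hμ => ?_)
  have := hμ.1
  have h0 := probMeasuresOn_compl_eq_zero Set.inter_subset_right hμ
  exact ENNReal.div_le_of_le_mul'
    ((ofReal_rpow_le_tsum_dyadicEnergy hl h0).trans (hE a l hl hl' μ hμ.1 h0))

/-- A **Poincaré inequality** on arcs, in terms of the capacity of a set of radial zeros. -/
lemma exists_poincare_capacity (hβ : 0 < β) (hβα : β ≤ α) (hα : α ≤ 1) :
    ∃ C : ℝ, 0 < C ∧ ∀ (a l : ℝ), 0 < l → l ≤ 2 * Real.pi →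
    ∀ f u : ℂ → ℂ, MemLp u 2 normArcLength → totalDirichlet β u ≠ ⊤ →
    DifferentiableOn ℂ f (Metric.ball 0 1) →
    (∀ z : ℂ, ‖z‖ < 1 → f z = ∫ w, (poissonKernel 0 z w : ℂ) * u w ∂normArcLength) →
    ∀ E : Set ℂ, (∀ z ∈ E, HasRadialLimit f z 0) → ∀ D : ℝ, 0 < D →
    ∫⁻ x in arc a l, ∫⁻ y in arc a l, dirichletKernel α u x y ∂arcLength ∂arcLength ≤
      ENNReal.ofReal D →
    ∫⁻ x in arc a l, ‖u x‖ₑ ^ 2 ∂arcLength ≤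
      ENNReal.ofReal (l * (C * (l ^ (α - β) * D))) * (capacity (1 - β) (E ∩ arc a l))⁻¹ := by
  obtain ⟨C, hC, hP⟩ := exists_poincare hβ (hβα.trans hα)
  refine ⟨C, hC, fun a l hl hl' f u hu hD hf hfu E hE D hD0 hDI => ?_⟩
  have hpos : 0 < l * (C * (l ^ (α - β) * D)) := by positivity
  -- The inverse capacity is an infimum of energies, so the inequality is proved for each μ;
  -- infinite energy is trivial.
  rw [capacity, inv_inv, ← ENNReal.div_le_iff' (by simpa using hpos) ENNReal.ofReal_ne_top]
  refine le_iInf₂ fun μ hμ => ?_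
  rcases eq_or_ne (energy (1 - β) μ) ⊤ with htop | htop
  · rw [htop]
    exact le_top
  refine ENNReal.div_le_of_le_mul' ?_
  have h0 := probMeasuresOn_compl_eq_zero Set.inter_subset_right hμ
  have hlim : ∀ᵐ z ∂μ, HasRadialLimit f z 0 := by
    have h1 : ∀ᵐ z ∂μ, z ∈ E := by
      rw [ae_iff]
      exact probMeasuresOn_compl_eq_zero Set.inter_subset_left hμ
    filter_upwards [h1] with z hz using hE z hz
  refine (hP a l hl hl' f u hu hD hf hfu μ hμ.1 h0 hlim htop).trans ?_
  -- Points of the arc are at distance at most l, so passing from order β to order α costs l^{α-β}.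
  have hβD : ∫⁻ x in arc a l, ∫⁻ y in arc a l, dirichletKernel β u x y ∂arcLength ∂arcLength ≤
      ENNReal.ofReal (l ^ (α - β)) * ENNReal.ofReal D := by
    refine le_trans ?_ (mul_le_mul_right hDI _)
    rw [← lintegral_const_mul' _ _ ENNReal.ofReal_ne_top]
    refine setLIntegral_mono' measurableSet_arc fun x hx => ?_
    rw [← lintegral_const_mul' _ _ ENNReal.ofReal_ne_top]
    refine setLIntegral_mono' measurableSet_arc fun y hy => dirichletKernel_le_of_le hβα ?_
    rw [← dyadicArc_zero hl] at hx hy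
    simpa using (norm_sub_lt_of_mem_dyadicArc hl hx hy).le
  rw [ENNReal.ofReal_mul hl.le, ENNReal.ofReal_mul hC.le, ENNReal.ofReal_mul (by positivity)]
  calc _ ≤ ENNReal.ofReal l * (ENNReal.ofReal C * energy (1 - β) μ *
        (ENNReal.ofReal (l ^ (α - β)) * ENNReal.ofReal D)) := by gcongr
    _ = _ := by ring

/-- Jensen's inequality for the logarithm, obtained by integrating log t ≤ t - 1 at t = |u|²/m
together with log|u| ≥ -log⁻|u|. -/
lemma neg_two_mul_negLog_le {S : Set ℂ} {m : ℝ} (hl : 0 < l)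
    (hSl : arcLength S = ENNReal.ofReal l) (hm : 0 < m)
    (hu : AEStronglyMeasurable u arcLength)
    (hb : ∫⁻ x in S, ‖u x‖ₑ ^ 2 ∂arcLength ≤ ENNReal.ofReal (l * m))
    (hfin : ∫⁻ x in S, negLog (u x) ∂arcLength ≠ ⊤) :
    -2 * (∫⁻ x in S, negLog (u x) ∂arcLength).toReal ≤ l * Real.log m := by
  have hnm : AEMeasurable (fun x => negLog (u x)) (arcLength.restrict S) :=
    continuous_negLog.measurable.comp_aemeasurable hu.aemeasurable.restrict
  have hni := integrable_toReal_of_lintegral_ne_top hnm hfin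
  have hae := ae_lt_top' hnm hfin
  have hsq : ∀ x, ENNReal.ofReal (‖u x‖ ^ 2) = ‖u x‖ₑ ^ 2 := fun x => by
    rw [ENNReal.ofReal_pow (norm_nonneg _), ofReal_norm]
  have hsi : Integrable (fun x => ‖u x‖ ^ 2) (arcLength.restrict S) := by
    refine ⟨(hu.norm.pow 2).restrict, ?_⟩
    rw [hasFiniteIntegral_iff_ofReal (ae_of_all _ fun x => by positivity)]
    simp_rw [hsq]
    exact hb.trans_lt ENNReal.ofReal_lt_top
  have hsqle : ∫ x in S, ‖u x‖ ^ 2 ∂arcLength ≤ l * m := by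
    rw [integral_eq_lintegral_of_nonneg_ae (ae_of_all _ fun x => by positivity) hsi.1]
    simp_rw [hsq]
    exact ENNReal.toReal_le_of_le_ofReal (by positivity) hb
  have hkey : ∫ _ in S, (1 - Real.log m) ∂arcLength ≤
      ∫ x in S, (‖u x‖ ^ 2 * m⁻¹ + 2 * (negLog (u x)).toReal) ∂arcLength := by
    refine integral_mono_ae (by
      have : IsFiniteMeasure (arcLength.restrict S) := inferInstance
      exact integrable_const _) ((hsi.mul_const _).add (hni.const_mul 2)) ?_
    filter_upwards [hae] with x hx
    have hx0 : u x ≠ 0 := by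
      intro h
      rw [h, negLog_zero] at hx
      exact lt_irrefl _ hx
    have hn : 0 < ‖u x‖ := norm_pos_iff.2 hx0
    rw [negLog_of_ne_zero hx0, ENNReal.toReal_ofReal']
    have h1 := Real.log_le_sub_one_of_pos (show 0 < ‖u x‖ ^ 2 * m⁻¹ by positivity)
    rw [Real.log_mul (by positivity) (by positivity), Real.log_pow, Real.log_inv] at h1
    have h2 := le_max_left (-Real.log ‖u x‖) 0
    push_cast at h1
    linarith
  rw [integral_add (hsi.mul_const _) (hni.const_mul 2), integral_mul_const, integral_const_mul,
    integral_toReal hnm hae, setIntegral_const, measureReal_def, hSl,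
    ENNReal.toReal_ofReal hl.le, smul_eq_mul] at hkey
  have h3 : (∫ x in S, ‖u x‖ ^ 2 ∂arcLength) * m⁻¹ ≤ l := by
    rw [← div_eq_mul_inv, div_le_iff₀ hm]
    exact hsqle
  linarith

lemma logTerm_arc_of_capacity_eq_zero (hl : 0 < l) (hl' : l ≤ 2 * Real.pi) {E : Set ℂ}
    (hc : capacity (1 - β) (E ∩ arc a l) = 0) : logTerm α β E (arc a l) = ⊤ := by
  have h0 : ENNReal.ofReal l ^ (1 + α - β) ≠ 0 := by
    rw [ENNReal.ofReal_rpow_of_pos hl]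
    have : 0 < l ^ (1 + α - β) := by positivity
    simpa using this
  rw [logTerm, hc, arcLength_arc hl hl', ENNReal.div_zero h0, ENNReal.log_top]
  refine EReal.mul_top_of_pos ?_
  rw [EReal.coe_ennreal_pos]
  simpa using hl

lemma logTerm_arc_of_capacity_eq (hl : 0 < l) (hl' : l ≤ 2 * Real.pi) {E : Set ℂ} {c : ℝ}
    (hc0 : 0 < c) (hc : capacity (1 - β) (E ∩ arc a l) = ENNReal.ofReal c) :
    logTerm α β E (arc a l) = ((l * Real.log (l ^ (1 + α - β) / c) : ℝ) : EReal) := by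
  rw [logTerm, hc, arcLength_arc hl hl', ENNReal.ofReal_rpow_of_pos hl,
    ← ENNReal.ofReal_div_of_pos hc0, ENNReal.log_ofReal_of_pos (by positivity), EReal.coe_mul,
    EReal.coe_ennreal_ofReal, max_eq_left hl.le]

lemma sum_ne_bot_of_ne_bot {t : ℕ → EReal} (ht : ∀ n, t n ≠ ⊥) (N : ℕ) :
    ∑ n ∈ Finset.range N, t n ≠ ⊥ := by
  induction N with
  | zero => simp
  | succ N ih =>
    rw [Finset.sum_range_succ]
    simp [EReal.add_eq_bot_iff, ih, ht]

/-- Once a term is ⊤, all later partial sums are ⊤. The absence of ⊥ terms is essential, since ⊤ + ⊥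
= ⊥ in `EReal`. -/
lemma ne_top_of_tendsto_sum_bot {t : ℕ → EReal} (ht : ∀ n, t n ≠ ⊥)
    (hsum : Tendsto (fun N => ∑ n ∈ Finset.range N, t n) atTop (𝓝 ⊥)) (n : ℕ) : t n ≠ ⊤ := by
  intro hn
  have htop : ∀ N, n < N → ∑ k ∈ Finset.range N, t k = ⊤ := by
    intro N hN
    induction N, hN using Nat.le_induction with
    | base =>
      rw [Finset.sum_range_succ, hn]
      exact EReal.add_top_of_ne_bot (sum_ne_bot_of_ne_bot ht n)
    | succ N _ ih =>
      rw [Finset.sum_range_succ, ih]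
      exact EReal.top_add_of_ne_bot (ht N)
  have h1 : Tendsto (fun N => ∑ n ∈ Finset.range N, t n) atTop (𝓝 ⊤) :=
    tendsto_const_nhds.congr' (by
      filter_upwards [eventually_gt_atTop n] with N hN using (htop N hN).symm)
  exact absurd (tendsto_nhds_unique hsum h1) (by simp)

lemma lintegral_arcLength (F : ℂ → ℝ≥0∞) :
    ∫⁻ z, F z ∂arcLength = ENNReal.ofReal (2 * Real.pi) * ∫⁻ z, F z ∂normArcLength := by
  rw [arcLength_eq_smul, lintegral_smul_measure, smul_eq_mul]

lemma totalDirichlet_eq (α : ℝ) (u : ℂ → ℂ) :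
    totalDirichlet α u = ENNReal.ofReal (2 * Real.pi) * dirichletIntegral α u := by
  rw [totalDirichlet, dirichletIntegral, ← lintegral_const_mul' _ _ ENNReal.ofReal_ne_top]
  refine lintegral_congr fun z => ?_
  rw [lintegral_arcLength]
  rfl

lemma totalDirichlet_le (hβα : β ≤ α) (u : ℂ → ℂ) :
    totalDirichlet β u ≤ ENNReal.ofReal (2 ^ (α - β)) * totalDirichlet α u := by
  rw [totalDirichlet, totalDirichlet, ← lintegral_const_mul' _ _ ENNReal.ofReal_ne_top]
  refine lintegral_mono_ae ?_
  filter_upwards [ae_normArcLength_norm_eq_one] with z hz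
  rw [← lintegral_const_mul' _ _ ENNReal.ofReal_ne_top]
  refine lintegral_mono_ae ?_
  filter_upwards [ae_arcLength_norm_eq_one] with w hw
  refine dirichletKernel_le_of_le hβα ((norm_sub_le z w).trans ?_)
  rw [hz, hw]
  norm_num

lemma sum_setLIntegral_le {X : Type*} [MeasurableSpace X] {μ : Measure X} {I : ℕ → Set X}
    (hI : ∀ n, MeasurableSet (I n)) (hdisj : Pairwise fun m n => Disjoint (I m) (I n))
    (F : X → ℝ≥0∞) (N : ℕ) :
    ∑ n ∈ Finset.range N, ∫⁻ x in I n, F x ∂μ ≤ ∫⁻ x, F x ∂μ := by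
  rw [← lintegral_biUnion_finset (fun i _ j _ hij => hdisj hij) (fun n _ => hI n)]
  exact setLIntegral_le_lintegral _ _

end

end DirichletUniqueness

/-! ### The uniqueness theorem. -/

open DirichletUniqueness in
theorem theorem3p1 (α β : ℝ) (hβ : 0 < β) (hβα : β ≤ α) (hα : α ≤ 1)
    (E : Set ℂ) (hE : E ⊆ DirichletUniqueness.unitCircle) (hEm : MeasurableSet E)
    (hE0 : DirichletUniqueness.arcLength E = 0)
    (I : ℕ → Set ℂ) (hI : ∀ n, DirichletUniqueness.IsOpenArc (I n))
    (hdisj : Pairwise fun m n => Disjoint (I m) (I n))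
    (hcov : E ⊆ ⋃ n, I n)
    (hsum : Tendsto
      (fun N : ℕ => ∑ n ∈ Finset.range N, DirichletUniqueness.logTerm α β E (I n))
      atTop (𝓝 (⊥ : EReal))) :
    DirichletUniqueness.IsUniquenessSet α E := by
  intro f hf hlim z₀ hz₀
  by_contra hfz
  obtain ⟨hH, hDir⟩ := hf
  obtain ⟨-, hu, hfu⟩ := hH.boundaryValue_spec
  have hlogfin := hH.lintegral_negLog_lt_top hz₀ hfz
  set u := boundaryValue f
  have hum : AEStronglyMeasurable u arcLength := hu.1.mono_ac arcLength_absolutelyContinuous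
  have hDα : totalDirichlet α u ≠ ⊤ := by
    rw [totalDirichlet_eq]
    exact ENNReal.mul_ne_top ENNReal.ofReal_ne_top hDir.ne
  have hDβ : totalDirichlet β u ≠ ⊤ :=
    ((totalDirichlet_le hβα u).trans_lt
      (ENNReal.mul_lt_top ENNReal.ofReal_lt_top hDα.lt_top)).ne
  choose a l hl hl' hIarc using fun n => (hI n).exists_angle
  replace hIarc : ∀ n, I n = arc (a n) (l n) := hIarc
  obtain ⟨C, hC, hP⟩ := exists_poincare_capacity hβ hβα hα
  have hcap : ∀ n, capacity (1 - β) (E ∩ I n) ≠ ⊤ := fun n => by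
    rw [hIarc]
    exact (capacity_inter_arc_lt_top (hβα.trans hα) (hl n) (hl' n) E).ne
  have hterm : ∀ n, capacity (1 - β) (E ∩ I n) ≠ 0 → logTerm α β E (I n) =
      ((l n * Real.log (l n ^ (1 + α - β) / (capacity (1 - β) (E ∩ I n)).toReal) : ℝ) :
        EReal) := fun n hn => by
    have h1 := ENNReal.toReal_pos hn (hcap n)
    have h2 := ENNReal.ofReal_toReal (hcap n)
    rw [hIarc] at h1 h2 ⊢
    exact logTerm_arc_of_capacity_eq (hl n) (hl' n) h1 h2.symm
  have hterm0 : ∀ n, capacity (1 - β) (E ∩ I n) = 0 → logTerm α β E (I n) = ⊤ := fun n hn => by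
    rw [hIarc] at hn ⊢
    exact logTerm_arc_of_capacity_eq_zero (hl n) (hl' n) hn
  -- A vanishing capacity would give a term ⊤, which is incompatible with partial sums tending to ⊥;
  -- from here on all terms are real.
  have hcap0 : ∀ n, capacity (1 - β) (E ∩ I n) ≠ 0 := fun n hn => by
    refine ne_top_of_tendsto_sum_bot (fun k => ?_) hsum n (hterm0 n hn)
    by_cases hk : capacity (1 - β) (E ∩ I k) = 0
    · simp [hterm0 k hk]
    · rw [hterm k hk]
      exact EReal.coe_ne_bot _
  set c : ℕ → ℝ := fun n => (capacity (1 - β) (E ∩ I n)).toReal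
  have hc : ∀ n, 0 < c n := fun n => ENNReal.toReal_pos (hcap0 n) (hcap n)
  set L : ℕ → ℝ := fun n => l n * Real.log (l n ^ (1 + α - β) / c n)
  set T : ℝ≥0∞ := ∫⁻ x, ∫⁻ y, dirichletKernel α u x y ∂arcLength ∂arcLength with hT
  have hTfin : T ≠ ⊤ := by
    rw [hT, lintegral_arcLength]
    exact ENNReal.mul_ne_top ENNReal.ofReal_ne_top hDα
  set D : ℕ → ℝ≥0∞ := fun n =>
    ∫⁻ x in I n, ∫⁻ y in I n, dirichletKernel α u x y ∂arcLength ∂arcLength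
  have hDle : ∀ n, D n ≤ ∫⁻ x in I n, ∫⁻ y, dirichletKernel α u x y ∂arcLength ∂arcLength :=
    fun n => lintegral_mono fun x => setLIntegral_le_lintegral _ _
  have hDsum : ∀ N, ∑ n ∈ Finset.range N, D n ≤ T := fun N =>
    (Finset.sum_le_sum fun n _ => hDle n).trans
      (sum_setLIntegral_le (fun n => (hI n).measurableSet) hdisj _ N)
  have hDfin : ∀ n, D n ≠ ⊤ := fun n =>
    ((hDle n).trans (setLIntegral_le_lintegral _ _)).trans_lt hTfin.lt_top |>.ne
  set H : ℕ → ℝ≥0∞ := fun n => ∫⁻ x in I n, negLog (u x) ∂arcLength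
  set K : ℝ≥0∞ := ∫⁻ x, negLog (u x) ∂arcLength with hK
  have hKfin : K ≠ ⊤ := by
    rw [hK, lintegral_arcLength]
    exact ENNReal.mul_ne_top ENNReal.ofReal_ne_top hlogfin.ne
  have hHsum : ∀ N, ∑ n ∈ Finset.range N, H n ≤ K := fun N =>
    sum_setLIntegral_le (fun n => (hI n).measurableSet) hdisj _ N
  have hHfin : ∀ n, H n ≠ ⊤ := fun n =>
    (setLIntegral_le_lintegral _ _).trans_lt hKfin.lt_top |>.ne
  have hlsum : ∀ N, ∑ n ∈ Finset.range N, l n ≤ 2 * Real.pi := by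
    intro N
    have h1 := sum_setLIntegral_le (μ := arcLength) (fun n => (hI n).measurableSet) hdisj
      (fun _ => 1) N
    simp only [lintegral_const, one_mul, Measure.restrict_apply_univ, arcLength_univ] at h1
    have h2 : ∀ n, arcLength (I n) = ENNReal.ofReal (l n) := fun n => by
      rw [hIarc, arcLength_arc (hl n) (hl' n)]
    simp_rw [h2] at h1
    rw [← ENNReal.ofReal_sum_of_nonneg fun n _ => (hl n).le] at h1
    exact (ENNReal.ofReal_le_ofReal_iff Real.two_pi_pos.le).1 h1
  have hmain : ∀ n, -2 * (H n).toReal ≤ L n + C * ((D n).toReal + l n) := by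
    intro n
    have hln := hl n
    have hcn := hc n
    -- The local Dirichlet integral may vanish; adding the length makes it positive, so its
    -- logarithm is meaningful, and costs at most 2π in the sum over n.
    have hD0 : 0 < (D n).toReal + l n := add_pos_of_nonneg_of_pos ENNReal.toReal_nonneg hln
    set d := (D n).toReal + l n with hd
    have hm : 0 < C * (l n ^ (α - β) * d) / c n := by positivity
    have hb := hP (a n) (l n) hln (hl' n) f u hu hDβ hH.1 hfu E hlim d hD0 (by
      rw [← hIarc]
      change D n ≤ _
      rw [← ENNReal.ofReal_toReal (hDfin n)]
      exact ENNReal.ofReal_le_ofReal (by linarith))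
    rw [← hIarc, ← ENNReal.ofReal_toReal (hcap n), ← ENNReal.ofReal_inv_of_pos hcn,
      ← ENNReal.ofReal_mul (by positivity)] at hb
    have h1 := neg_two_mul_negLog_le hln
      (by rw [hIarc, arcLength_arc hln (hl' n)]) hm hum
      (hb.trans_eq (congrArg _ (by rw [div_eq_mul_inv]; ring))) (hHfin n)
    refine h1.trans ?_
    -- Splits off the argument of the logarithm in the hypothesis; the other factor contributes l
    -- log(Cd/l) ≤ Cd, which is summable.
    have h2 : C * (l n ^ (α - β) * d) / c n =
        (l n ^ (1 + α - β) / c n) * (C * d / l n) := by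
      rw [add_sub_assoc, Real.rpow_add hln, Real.rpow_one]
      field_simp
    rw [h2, Real.log_mul (by positivity) (by positivity), mul_add]
    have h3 := Real.log_le_self (show 0 ≤ C * d / l n by positivity)
    have h4 : l n * Real.log (C * d / l n) ≤ C * d := by
      calc _ ≤ l n * (C * d / l n) := by gcongr
        _ = _ := by field_simp
    linarith
  have hlower : ∀ N, -2 * K.toReal - C * (T.toReal + 2 * Real.pi) ≤
      ∑ n ∈ Finset.range N, L n := by
    intro N
    have h1 := Finset.sum_le_sum fun n (_ : n ∈ Finset.range N) => hmain n
    rw [← Finset.mul_sum, Finset.sum_add_distrib, ← Finset.mul_sum, Finset.sum_add_distrib,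
      ← ENNReal.toReal_sum fun n _ => hHfin n, ← ENNReal.toReal_sum fun n _ => hDfin n] at h1
    have h2 := ENNReal.toReal_mono hKfin (hHsum N)
    have h3 := ENNReal.toReal_mono hTfin (hDsum N)
    have h4 := hlsum N
    nlinarith
  have hcoe : ∀ N, ∑ n ∈ Finset.range N, logTerm α β E (I n) =
      ((∑ n ∈ Finset.range N, L n : ℝ) : EReal) := by
    intro N
    induction N with
    | zero => simp
    | succ N ih =>
      rw [Finset.sum_range_succ, Finset.sum_range_succ, ih, hterm N (hcap0 N), EReal.coe_add]
  obtain ⟨N, hN⟩ := (hsum.eventually_lt_const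
    (EReal.bot_lt_coe (-2 * K.toReal - C * (T.toReal + 2 * Real.pi)))).exists
  rw [hcoe, EReal.coe_lt_coe_iff] at hN
  exact absurd (hlower N) (not_le.2 hN)
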